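/- Let $R$ be a commutative ring with identity which is a valuation ring in the general sense (zero divisors allowed), i.e. its ideals are totally ordered by inclusion. An $R$-module is uniserial if its submodules are totally ordered by inclusion. We use the following terms. - $R$ is maximal if every family of cosets $(a_i+L_i)_{i\in I}$, with $a_i\in R$, $L_i$ an ideal of $R$ and $I$ an arbitrary index set, which has the finite intersection property has a non-empty intersection. - An $R$-module $M$ is singly projective if for every cyclic submodule $N$ of $M$ the inclusion map $N\to M$ factors through a free module. - $M$ is separable if every finite subset of $M$ is contained in a direct summand of $M$ which is a finite direct sum of uniserial submodules. - $M$ is locally projective if for every finitely generated submodule $N$ of $M$ there exist a free module $F$ and homomorphisms $\phi:M\to F$ and $\pi:F\to M$ such that $\pi(\phi(x))=x$ for all $x\in N$. - For $x\in M$, the content ideal $\mathrm{c}(x)$ is the intersection of all ideals $A$ of $R$ with $x\in AM$; $M$ is a content module if $x\in \mathrm{c}(x)M$ for all $x\in M$. **Theorem.** The following conditions are equivalent: 1. $R$ is maximal; 2. every singly projective $R$-module is separable; 3. every flat content $R$-module is locally projective. -/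

import Mathlib

universe u v

/-- A module is uniserial if its submodules are totally ordered by inclusion. -/
def IsUniserialModule (R : Type u) (M : Type v) [CommRing R] [AddCommGroup M] [Module R M] :
    Prop :=
  ∀ N K : Submodule R M, N ≤ K ∨ K ≤ N

/-- A commutative ring (possibly with zero divisors) is a valuation ring, in the general sense,
if it is uniserial as a module over itself. -/
def IsUniserialValuationRing (R : Type u) [CommRing R] : Prop :=
  IsUniserialModule R R

/-- `R` is maximal: every family of cosets `a i + L i` of ideals with the finite intersection
property has a non-empty intersection. -/
def IsMaximalValuationRing (R : Type u) [CommRing R] : Prop :=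
  ∀ (ι : Type u) (a : ι → R) (L : ι → Ideal R),
    (∀ s : Finset ι, ∃ x : R, ∀ i ∈ s, x - a i ∈ L i) → ∃ x : R, ∀ i, x - a i ∈ L i

/-- `M` is singly projective: for every cyclic submodule `N`, the inclusion `N → M` factors
through a free module. -/
def IsSinglyProjective (R : Type u) (M : Type v) [CommRing R] [AddCommGroup M] [Module R M] :
    Prop :=
  ∀ x : M, ∃ (F : Type (max u v)) (_ : AddCommGroup F) (_ : Module R F) (_ : Module.Free R F)
    (φ : Submodule.span R {x} →ₗ[R] F) (π : F →ₗ[R] M),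
      π ∘ₗ φ = (Submodule.span R {x}).subtype

/-- `M` is locally projective: for every finitely generated submodule `N` there are a free module
`F` and linear maps `φ : M → F`, `π : F → M` with `π (φ x) = x` for all `x ∈ N`. -/
def IsLocallyProjective (R : Type u) (M : Type v) [CommRing R] [AddCommGroup M] [Module R M] :
    Prop :=
  ∀ N : Submodule R M, N.FG →
    ∃ (F : Type (max u v)) (_ : AddCommGroup F) (_ : Module R F) (_ : Module.Free R F)
      (φ : M →ₗ[R] F) (π : F →ₗ[R] M), ∀ x ∈ N, π (φ x) = x

/-- The content ideal of `x` in `M`: the intersection of all ideals `A` with `x ∈ A M`. -/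
def moduleContentIdeal (R : Type u) {M : Type v} [CommRing R] [AddCommGroup M] [Module R M]
    (x : M) : Ideal R :=
  sInf {A : Ideal R | x ∈ A • (⊤ : Submodule R M)}

/-- `M` is a content module: `x ∈ c(x) M` for all `x`, where `c(x)` is the content ideal. -/
def IsContentModule (R : Type u) (M : Type v) [CommRing R] [AddCommGroup M] [Module R M] :
    Prop :=
  ∀ x : M, x ∈ moduleContentIdeal R x • (⊤ : Submodule R M)

/-- `M` is separable: every finite subset is contained in a direct summand of `M` which is the
internal direct sum of finitely many uniserial submodules. -/
def IsSeparableModule (R : Type u) (M : Type v) [CommRing R] [AddCommGroup M] [Module R M] :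
    Prop :=
  ∀ S : Set M, S.Finite → ∃ N : Submodule R M, S ⊆ N ∧ (∃ N' : Submodule R M, IsCompl N N') ∧
    ∃ (n : ℕ) (U : Fin n → Submodule R M),
      (∀ i, IsUniserialModule R (U i)) ∧ iSupIndep U ∧ (⨆ i, U i) = N

/-! ### Divisibility as a total relation: consequences for scalars and finite combinations. -/

section Divisibility

variable {R : Type u} [CommRing R]

/-! Of two scalars one divides the other, so a finite combination collapses to a single multiple.
Flatness, content and single projectivity thereby become conditions on factorizations `x = r • w`:
`AnnihilatorDivisible`, `HasContentFactors`, `HasAnnihilatorFactors`.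

From maximality: a partial map that preserves divisibility extends to the whole module if its target
is `CosetCompact` (`LinearPMap.PreservesDivisibility.exists_extension`). Over a maximal ring
uniserial modules are coset-compact, so a pure uniserial submodule is a direct summand. In a flat
content module a non-zero `x` is a multiple of some `w` divisible by no non-unit, and `R ∙ w` is
pure and free. In a singly projective module `x` is a multiple of some `y` with zero annihilator,
and `regularClosure y` is pure and uniserial. Splitting off such summands one at a time absorbs a
finite set.

Towards maximality: `R` embeds purely, by `1 ↦ e`, in the circle dual `N` of its character module.
`N` is compact and its submodules `{v | a • v ∈ s • N}` form a chain, so it is coset-compact. Let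
`K` be maximal among the submodules modulo which `e` stays pure. Some idempotent `g` fixes `e` and
has kernel `K`; its image `Y` plays the role of a pure-injective hull of `R`. Maximality of `K`
makes `Y` a flat content module, hence also singly projective, so condition 2 as well as condition 3
applies to `Y` and gives `ρ : Y → R` with `ρ e = 1`. Since `Y` contains limits of principal cosets
of `R`, `ρ` carries these limits into `R`. -/

theorem IsUniserialValuationRing.dvd_total (hR : IsUniserialValuationRing R) (a b : R) :
    a ∣ b ∨ b ∣ a := by
  rcases hR (Ideal.span {a}) (Ideal.span {b}) with h | h
  · exact Or.inr (Ideal.span_singleton_le_span_singleton.mp h)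
  · exact Or.inl (Ideal.span_singleton_le_span_singleton.mp h)

theorem isUnit_one_sub_of_not_isUnit (hd : ∀ a b : R, a ∣ b ∨ b ∣ a) {q : R} (hq : ¬ IsUnit q) :
    IsUnit (1 - q) := by
  rcases hd q (1 - q) with h | h
  · refine absurd (isUnit_of_dvd_one ?_) hq
    have := dvd_add h (dvd_refl q)
    rwa [sub_add_cancel] at this
  · refine isUnit_of_dvd_one ?_
    have := dvd_add (dvd_refl (1 - q)) h
    rwa [sub_add_cancel] at this

/-- Nakayama for a principal ideal: `c = c * q * d` gives `c * (1 - q * d) = 0`, and `1 - q * d` is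
a unit. Most contradictions below end here. -/
theorem eq_zero_of_mul_dvd (hd : ∀ a b : R, a ∣ b ∨ b ∣ a) {c q : R} (hq : ¬ IsUnit q)
    (h : c * q ∣ c) : c = 0 := by
  obtain ⟨d, hc⟩ := h
  have hqd : ¬ IsUnit (q * d) := fun h => hq (isUnit_of_mul_isUnit_left h)
  have h0 : c * (1 - q * d) = 0 := by linear_combination hc
  exact (isUnit_one_sub_of_not_isUnit hd hqd).mul_left_eq_zero.mp h0

/-- If `s` does not divide `c` then `s` is a non-unit multiple of `c`. -/
theorem exists_eq_mul_of_not_dvd (hd : ∀ a b : R, a ∣ b ∨ b ∣ a) {s c : R} (h : ¬ s ∣ c) :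
    ∃ q, ¬ IsUnit q ∧ s = c * q := by
  obtain ⟨q, rfl⟩ := (hd s c).resolve_left h
  exact ⟨q, fun hq => h (hq.mul_right_dvd.mpr (dvd_refl c)), rfl⟩

/-- A finite combination is a multiple of one element, by one of the coefficients. -/
theorem exists_sum_smul_eq_smul (hd : ∀ a b : R, a ∣ b ∨ b ∣ a) {M : Type v} [AddCommGroup M]
    [Module R M] {κ : Type*} (s : Finset κ) (c : κ → R) (m : κ → M) :
    (∑ j ∈ s, c j • m j = 0) ∨ ∃ j ∈ s, ∃ w, ∑ i ∈ s, c i • m i = c j • w := by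
  classical
  induction s using Finset.induction_on with
  | empty => left; simp
  | insert a s ha ih =>
    right
    rw [Finset.sum_insert ha]
    rcases ih with h | ⟨j, hj, w, hw⟩
    · exact ⟨a, by simp, m a, by rw [h, add_zero]⟩
    · rw [hw]
      rcases hd (c a) (c j) with ⟨d, h⟩ | ⟨d, h⟩
      · exact ⟨a, by simp, m a + d • w, by rw [h, smul_add, smul_smul]⟩
      · exact ⟨j, by simp [hj], d • m a + w, by rw [h, smul_add, smul_smul]⟩

theorem exists_add_smul_eq_smul (hd : ∀ a b : R, a ∣ b ∨ b ∣ a) {M : Type v} [AddCommGroup M]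
    [Module R M] (a b : R) (x y : M) :
    ∃ c w, (c = a ∨ c = b) ∧ a • x + b • y = c • w := by
  rcases hd a b with ⟨d, h⟩ | ⟨d, h⟩
  · exact ⟨a, x + d • y, Or.inl rfl, by rw [h, smul_add, smul_smul]⟩
  · exact ⟨b, d • x + y, Or.inr rfl, by rw [h, smul_add, smul_smul]⟩

end Divisibility

/-! ### Coset compactness and chains of cosets. -/

section CosetCompact

/-- Families of cosets of the subgroups `{v | a • v ∈ s • U}` which meet pairwise have a common
point. -/
def CosetCompact (R : Type u) (U : Type v) [CommRing R] [AddCommGroup U] [Module R U] : Prop :=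
  ∀ (ι : Type u) (x : ι → U) (a s : ι → R),
    (∀ i j, ∃ v w w' : U, a i • (v - x i) = s i • w ∧ a j • (v - x j) = s j • w') →
    ∃ v : U, ∀ i, ∃ w : U, a i • (v - x i) = s i • w

/-- The submodule `{v | a • v ∈ s • U}`. -/
def smulColon {R : Type u} (U : Type v) [CommRing R] [AddCommGroup U] [Module R U] (a s : R) :
    Submodule R U :=
  (LinearMap.range (LinearMap.lsmul R U s)).comap (LinearMap.lsmul R U a)

theorem mem_smulColon {R : Type u} {U : Type v} [CommRing R] [AddCommGroup U] [Module R U]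
    {a s : R} {v : U} : v ∈ smulColon U a s ↔ ∃ w : U, a • v = s • w := by
  simp [smulColon, eq_comm]

/-- In a finite chain of pairwise meeting cosets, the smallest one is contained in all others. -/
theorem exists_common_coset_representative {R : Type u} {U : Type v} [CommRing R] [AddCommGroup U]
    [Module R U] {ι : Type*} (x : ι → U) (V : ι → Submodule R U)
    (hV : ∀ i j, V i ≤ V j ∨ V j ≤ V i) (hx : ∀ i j, x i - x j ∈ V i ⊔ V j) (s : Finset ι)
    (hs : s.Nonempty) : ∃ m ∈ s, ∀ i ∈ s, x m - x i ∈ V i := by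
  have key : ∃ m ∈ s, ∀ i ∈ s, V m ≤ V i := by
    classical
    induction hs using Finset.Nonempty.cons_induction with
    | singleton a => exact ⟨a, by simp⟩
    | cons a s ha hs ih =>
      obtain ⟨m, hm, h⟩ := ih
      rcases hV a m with h' | h'
      · exact ⟨a, by simp, by
          intro i hi
          rcases Finset.mem_cons.mp hi with rfl | hi
          · exact le_rfl
          · exact h'.trans (h i hi)⟩
      · exact ⟨m, by simp [hm], by
          intro i hi
          rcases Finset.mem_cons.mp hi with rfl | hi
          · exact h'
          · exact h i hi⟩
  obtain ⟨m, hm, h⟩ := key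
  refine ⟨m, hm, fun i hi => ?_⟩
  have := hx m i
  rwa [sup_eq_right.mpr (h i hi)] at this

end CosetCompact

/-! ### Extending maps that preserve divisibility. -/

section Extension

variable {R : Type u} [CommRing R] {M U : Type u} [AddCommGroup M] [Module R M]
  [AddCommGroup U] [Module R U]

/-- A partial linear map which maps elements divisible by `s` to elements divisible by `s`. -/
def LinearPMap.PreservesDivisibility (f : M →ₗ.[R] U) : Prop :=
  ∀ (z : f.domain) (s : R) (m : M), (z : M) = s • m → ∃ w : U, f z = s • w

/-- Each relation `n + a • m ∈ s • M` constrains the image `v` of `m`. Two constraints are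
compatible because eliminating `m` leaves a divisibility inside the domain, which `f` preserves. -/
theorem LinearPMap.PreservesDivisibility.exists_pairwise (hd : ∀ a b : R, a ∣ b ∨ b ∣ a)
    {f : M →ₗ.[R] U} (hf : f.PreservesDivisibility) (m : M) (n₁ n₂ : f.domain) (a₁ a₂ s₁ s₂ : R)
    (h₁ : ∃ y : M, (n₁ : M) + a₁ • m = s₁ • y) (h₂ : ∃ y : M, (n₂ : M) + a₂ • m = s₂ • y) :
    ∃ v w₁ w₂ : U, f n₁ + a₁ • v = s₁ • w₁ ∧ f n₂ + a₂ • v = s₂ • w₂ := by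
  have single : ∀ (n : f.domain) (a s : R), (∃ y : M, (n : M) + a • m = s • y) →
      ∃ v w : U, f n + a • v = s • w := by
    rintro n a s ⟨y, hy⟩
    rcases hd a s with ⟨t, rfl⟩ | ⟨t, rfl⟩
    · obtain ⟨w, hw⟩ := hf n a (t • y - m) (by
        rw [smul_sub, smul_smul, ← hy, add_sub_cancel_right])
      exact ⟨-w, 0, by rw [hw, smul_neg, add_neg_cancel, smul_zero]⟩
    · obtain ⟨w, hw⟩ := hf n s (y - t • m) (by
        rw [smul_sub, smul_smul, ← hy, add_sub_cancel_right])
      exact ⟨0, w, by rw [hw, smul_zero, add_zero]⟩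
  have main : ∀ (n₁ n₂ : f.domain) (a₁ b s₁ s₂ : R),
      (∃ y : M, (n₁ : M) + a₁ • m = s₁ • y) → (∃ y : M, (n₂ : M) + (a₁ * b) • m = s₂ • y) →
      ∃ v w₁ w₂ : U, f n₁ + a₁ • v = s₁ • w₁ ∧ f n₂ + (a₁ * b) • v = s₂ • w₂ := by
    intro n₁ n₂ a₁ b s₁ s₂ h₁ h₂
    -- If `s₁ ∣ a₁`, every `v` meets the first constraint, so only the second matters.
    rcases hd s₁ a₁ with ⟨e, rfl⟩ | ⟨e, rfl⟩
    · obtain ⟨y, hy⟩ := h₁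
      obtain ⟨w, hw⟩ := hf n₁ s₁ (y - e • m) (by
        rw [smul_sub, smul_smul, ← hy, add_sub_cancel_right])
      obtain ⟨v, w₂, h⟩ := single _ _ _ h₂
      exact ⟨v, w + e • v, w₂, by rw [hw, smul_add, smul_smul], h⟩
    · obtain ⟨u₁, v₁, hu⟩ := single _ _ _ h₁
      obtain ⟨y₁, hy₁⟩ := h₁
      obtain ⟨y₂, hy₂⟩ := h₂
      have hn : ((n₂ - b • n₁ : f.domain) : M) = s₂ • y₂ - (b * (a₁ * e)) • y₁ := by
        rw [mul_smul b, ← hy₁, ← hy₂]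
        simp only [AddSubgroupClass.coe_sub, Submodule.coe_smul, smul_add, smul_smul, mul_comm b]
        abel
      have hfu : f n₁ = (a₁ * e) • v₁ - a₁ • u₁ := by rw [← hu, add_sub_cancel_right]
      rcases hd s₂ (b * (a₁ * e)) with ⟨c, hc⟩ | ⟨c, hc⟩
      · obtain ⟨w, hw⟩ := hf (n₂ - b • n₁) s₂ (y₂ - c • y₁) (by
          rw [hn, hc, smul_sub, smul_smul])
        refine ⟨u₁, v₁, w + c • v₁, hu, ?_⟩
        have : f n₂ = s₂ • w + b • f n₁ := by
          rw [← hw, ← f.map_smul, ← f.map_add, sub_add_cancel]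
        rw [this, hfu, smul_add, smul_smul s₂ c, ← hc]
        module
      · obtain ⟨w, hw⟩ := hf (n₂ - b • n₁) (b * (a₁ * e)) (c • y₂ - y₁) (by
          rw [hn, hc, smul_sub, smul_smul])
        -- Moving `u₁` by a multiple of `e` keeps the first constraint, as `s₁ = a₁ * e`; this
        -- multiple makes the second left side vanish.
        refine ⟨u₁ - e • (w + v₁), -w, 0, ?_, ?_⟩
        · rw [hfu]; module
        · have : f n₂ = (b * (a₁ * e)) • w + b • f n₁ := by
            rw [← hw, ← f.map_smul, ← f.map_add, sub_add_cancel]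
          rw [this, hfu]; module
  rcases hd a₁ a₂ with ⟨b, rfl⟩ | ⟨b, rfl⟩
  · exact main n₁ n₂ a₁ b s₁ s₂ h₁ h₂
  · obtain ⟨v, w₂, w₁, h, h'⟩ := main n₂ n₁ a₂ b s₂ s₁ h₂ h₁
    exact ⟨v, w₁, w₂, h', h⟩

/-- The constraints on the image of `m` are cosets that meet pairwise, so coset compactness gives a
value satisfying all of them. -/
theorem LinearPMap.PreservesDivisibility.exists_extension_step (hd : ∀ a b : R, a ∣ b ∨ b ∣ a)
    (hU : CosetCompact R U) {f : M →ₗ.[R] U} (hf : f.PreservesDivisibility) (m : M) :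
    ∃ g : M →ₗ.[R] U, f ≤ g ∧ g.PreservesDivisibility ∧ m ∈ g.domain := by
  have hsol : ∃ v : U, ∀ (n : f.domain) (a s : R), (∃ y : M, (n : M) + a • m = s • y) →
      ∃ w : U, f n + a • v = s • w := by
    let ι := {p : f.domain × R × R // ∃ y : M, (p.1 : M) + p.2.1 • m = p.2.2 • y}
    have hx : ∀ i : ι, ∃ v w : U, f i.1.1 + i.1.2.1 • v = i.1.2.2 • w := fun i => by
      obtain ⟨v, w, -, h, -⟩ := hf.exists_pairwise hd m _ _ _ _ _ _ i.2 i.2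
      exact ⟨v, w, h⟩
    choose x w₀ hxw using hx
    obtain ⟨v, hv⟩ := hU ι x (fun i => i.1.2.1) (fun i => i.1.2.2) (fun i j => by
      obtain ⟨v, w, w', h, h'⟩ := hf.exists_pairwise hd m _ _ _ _ _ _ i.2 j.2
      refine ⟨v, w - w₀ i, w' - w₀ j, ?_, ?_⟩
      · rw [smul_sub, smul_sub, ← h, ← hxw]; abel
      · rw [smul_sub, smul_sub, ← h', ← hxw]; abel)
    refine ⟨v, fun n a s h => ?_⟩
    obtain ⟨w, hw⟩ := hv ⟨(n, a, s), h⟩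
    refine ⟨w + w₀ ⟨(n, a, s), h⟩, ?_⟩
    have h2 := hxw ⟨(n, a, s), h⟩
    simp only at hw h2
    rw [smul_add, ← hw, ← h2, smul_sub]; abel
  obtain ⟨v, hv⟩ := hsol
  -- The constraints with `s = 0` are the linear relations of `m` over the domain; they make the
  -- extension well defined.
  have H : ∀ c : R, c • m = 0 → c • v = 0 := fun c hc => by
    obtain ⟨w, hw⟩ := hv 0 c 0 ⟨0, by simp [hc]⟩
    simpa using hw
  have Hc : ∀ (x : f.domain) (y : (LinearPMap.mkSpanSingleton' (σ := RingHom.id R) m v H).domain), (x : M) = y →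
      f x = (LinearPMap.mkSpanSingleton' (σ := RingHom.id R) m v H) y := by
    rintro x ⟨y, hy⟩ hxy
    obtain ⟨c, rfl⟩ := Submodule.mem_span_singleton.mp hy
    rw [LinearPMap.mkSpanSingleton'_apply]
    obtain ⟨w, hw⟩ := hv (-x) c 0 ⟨0, by simp [hxy]⟩
    rw [f.map_neg, zero_smul, neg_add_eq_zero] at hw
    exact hw
  refine ⟨f.sup _ Hc, LinearPMap.left_le_sup _ _ Hc, ?_, ?_⟩
  · rintro ⟨z, hz⟩ s y hzy
    obtain ⟨x, hx, z', hz', rfl⟩ := Submodule.mem_sup.mp hz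
    obtain ⟨c, rfl⟩ := Submodule.mem_span_singleton.mp hz'
    obtain ⟨w, hw⟩ := hv ⟨x, hx⟩ c s ⟨y, hzy⟩
    refine ⟨w, ?_⟩
    have happ := LinearPMap.sup_apply Hc ⟨x, hx⟩ ⟨c • m, hz'⟩ ⟨x + c • m, hz⟩ rfl
    rw [LinearPMap.mkSpanSingleton'_apply] at happ
    exact happ.trans hw
  · exact (LinearPMap.right_le_sup _ _ Hc).1 (Submodule.mem_span_singleton_self m)

/-- Partial maps preserving divisibility into coset-compact modules extend. -/
theorem LinearPMap.PreservesDivisibility.exists_extension (hd : ∀ a b : R, a ∣ b ∨ b ∣ a)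
    (hU : CosetCompact R U) {f : M →ₗ.[R] U} (hf : f.PreservesDivisibility) :
    ∃ g : M →ₗ[R] U, ∀ x : f.domain, g x = f x := by
  obtain ⟨h, hfh, hmax⟩ := zorn_le_nonempty₀ {g : M →ₗ.[R] U | g.PreservesDivisibility}
    (fun c hc hch y hy => by
      have hdir : DirectedOn (· ≤ ·) c := hch.directedOn
      refine ⟨LinearPMap.sSup c hdir, ?_, fun z hz => LinearPMap.le_sSup hdir hz⟩
      rintro ⟨z, hz⟩ s m hzm
      obtain ⟨g, hg, hzg⟩ := (LinearPMap.mem_domain_sSup_iff ⟨y, hy⟩ hdir).mp hz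
      obtain ⟨w, hw⟩ := hc hg ⟨z, hzg⟩ s m hzm
      exact ⟨w, by rw [← hw]; exact LinearPMap.sSup_apply hdir hg ⟨z, hzg⟩⟩) f hf
  have htop : h.domain = ⊤ := by
    refine eq_top_iff.mpr fun m _ => ?_
    obtain ⟨g, hhg, hg, hm⟩ := hmax.1.exists_extension_step hd hU m
    exact (hmax.2 hg hhg).1 hm
  refine ⟨h.toFun ∘ₗ (LinearEquiv.ofTop _ htop).symm.toLinearMap, fun x => ?_⟩
  exact (hfh.2 (x := x) (y := (LinearEquiv.ofTop _ htop).symm x) rfl).symm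

/-- A submodule which is coset-compact and closed under division is a direct summand. -/
theorem exists_retraction_of_pure (hd : ∀ a b : R, a ∣ b ∨ b ∣ a) (V : Submodule R M)
    (hV : CosetCompact R V) (hpure : ∀ z ∈ V, ∀ (s : R) (m : M), z = s • m → ∃ w ∈ V, z = s • w) :
    ∃ g : M →ₗ[R] V, ∀ x : V, g x = x := by
  obtain ⟨g, hg⟩ := LinearPMap.PreservesDivisibility.exists_extension hd hV
    (f := ⟨V, LinearMap.id⟩) (fun z s m h => by
      obtain ⟨w, hw, h⟩ := hpure z z.2 s m h
      exact ⟨⟨w, hw⟩, Subtype.ext h⟩)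
  exact ⟨g, hg⟩

end Extension

/-! ### Two sources of coset-compact modules: uniserial ones and compact ones. -/

section Criteria

variable {R : Type u} [CommRing R]

/-- The submodules `V i` form a chain. If some `V k` misses a `y`, then `V k ≤ R ∙ y`, and the
cosets of all `V i ≤ V k` pull back along `c ↦ c • y` to cosets of ideals of `R`. The larger `V i`
then take care of themselves. -/
theorem IsMaximalValuationRing.cosetCompact_of_isUniserialModule (hm : IsMaximalValuationRing R)
    {U : Type u} [AddCommGroup U] [Module R U] (hU : IsUniserialModule R U) :
    CosetCompact R U := by
  intro ι x a s hx
  set V : ι → Submodule R U := fun i => smulColon U (a i) (s i) with hVdef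
  have hpair : ∀ i j, x i - x j ∈ V i ⊔ V j := by
    intro i j
    obtain ⟨v, w, w', h, h'⟩ := hx i j
    have h1 : v - x i ∈ V i := mem_smulColon.mpr ⟨w, h⟩
    have h2 : v - x j ∈ V j := mem_smulColon.mpr ⟨w', h'⟩
    have := sub_mem (Submodule.mem_sup_right (S := V i) h2) (Submodule.mem_sup_left (T := V j) h1)
    rwa [sub_sub_sub_cancel_left] at this
  suffices ∃ v : U, ∀ i, v - x i ∈ V i by
    obtain ⟨v, hv⟩ := this
    exact ⟨v, fun i => mem_smulColon.mp (hv i)⟩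
  by_cases htop : ∀ i, V i = ⊤
  · exact ⟨0, fun i => by rw [htop i]; trivial⟩
  push Not at htop
  obtain ⟨k, hk⟩ := htop
  obtain ⟨y, hy⟩ : ∃ y, y ∉ V k := by
    by_contra! h
    exact hk (eq_top_iff.mpr fun y _ => h y)
  have hky : V k ≤ R ∙ y := (hU (V k) (R ∙ y)).resolve_right
    fun h => hy (h (Submodule.mem_span_singleton_self y))
  have hr : ∀ i : {i // V i ≤ V k}, ∃ r : R, r • y = x i - x k := fun i => by
    have := hpair i k
    rw [sup_eq_right.mpr i.2] at this
    exact Submodule.mem_span_singleton.mp (hky this)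
  choose r hr using hr
  obtain ⟨c, hc⟩ := hm {i // V i ≤ V k} r
    (fun i => (V i).comap (LinearMap.toSpanSingleton R U y)) (fun t => by
      rcases t.eq_empty_or_nonempty with rfl | ht
      · exact ⟨0, by simp⟩
      obtain ⟨m, -, h⟩ := exists_common_coset_representative
        (fun i : {i // V i ≤ V k} => x i) (fun i => V i) (fun i j => hU _ _)
        (fun i j => hpair i j) t ht
      refine ⟨r m, fun i hi => ?_⟩
      have := h i hi
      rw [Submodule.mem_comap, LinearMap.toSpanSingleton_apply, sub_smul, hr, hr]
      rwa [sub_sub_sub_cancel_right])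
  refine ⟨x k + c • y, fun i => ?_⟩
  by_cases hi : V i ≤ V k
  · have := hc ⟨i, hi⟩
    rw [Submodule.mem_comap, LinearMap.toSpanSingleton_apply, sub_smul, hr] at this
    convert this using 1
    abel
  · have hki : V k ≤ V i := (hU _ _).resolve_left hi
    have h1 : c • y ∈ V k := by
      have := hc ⟨k, le_rfl⟩
      rw [Submodule.mem_comap, LinearMap.toSpanSingleton_apply, sub_smul, hr] at this
      simpa using this
    have h2 := hpair k i
    rw [sup_eq_right.mpr hki] at h2
    convert add_mem h2 (hki h1) using 1
    abel

/-- Multiplication by `r` covers everything killed by `t`, whenever `t * r ≠ 0`. -/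
def KernelDivisible (R : Type u) (N : Type v) [CommRing R] [AddCommGroup N] [Module R N] : Prop :=
  ∀ (t r : R) (x : N), t * r ≠ 0 → t • x = 0 → ∃ y : N, x = r • y

theorem kernelDivisible_self (hd : ∀ a b : R, a ∣ b ∨ b ∣ a) : KernelDivisible R R := by
  intro t r x htr htx
  rcases hd r x with ⟨y, h⟩ | ⟨y, rfl⟩
  · exact ⟨y, h⟩
  · exact absurd (by rw [← mul_assoc, show t * x = 0 from htx, zero_mul]) htr

/-- Each such submodule is `N`, the image of a scalar, or the kernel of a scalar. Images are
comparable, and so are kernels, by divisibility; the image of `t` lies in the kernel of `a` when `a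
* t = 0` and contains it otherwise. -/
theorem KernelDivisible.smulColon_total (hd : ∀ a b : R, a ∣ b ∨ b ∣ a) {N : Type v}
    [AddCommGroup N] [Module R N] (hN : KernelDivisible R N) (a s a' s' : R) :
    smulColon N a s ≤ smulColon N a' s' ∨ smulColon N a' s' ≤ smulColon N a s := by
  have hrange : ∀ a s : R, smulColon N a s = ⊤ ∨
      (∃ t, smulColon N a s = LinearMap.range (LinearMap.lsmul R N t)) ∨
      (smulColon N a s = LinearMap.ker (LinearMap.lsmul R N a)) := by
    intro a s
    rcases hd s a with ⟨t, rfl⟩ | ⟨t, rfl⟩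
    · exact Or.inl (eq_top_iff.mpr fun v _ => mem_smulColon.mpr ⟨t • v, by rw [smul_smul]⟩)
    by_cases h : a * t = 0
    · refine Or.inr (Or.inr ?_)
      ext v
      simp [mem_smulColon, h]
    · refine Or.inr (Or.inl ⟨t, ?_⟩)
      ext v
      simp only [mem_smulColon, LinearMap.mem_range, LinearMap.lsmul_apply]
      constructor
      · rintro ⟨w, hw⟩
        obtain ⟨y, hy⟩ := hN a t (v - t • w) h (by rw [smul_sub, hw, smul_smul, sub_self])
        exact ⟨w + y, by rw [smul_add, ← hy, add_sub_cancel]⟩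
      · rintro ⟨w, rfl⟩
        exact ⟨w, by rw [smul_smul]⟩
  have range_le : ∀ t t' : R, t ∣ t' →
      LinearMap.range (LinearMap.lsmul R N t') ≤ LinearMap.range (LinearMap.lsmul R N t) := by
    rintro t _ ⟨c, rfl⟩ _ ⟨w, rfl⟩
    exact ⟨c • w, by simp [smul_smul, mul_comm]⟩
  have ker_le : ∀ t t' : R, t ∣ t' →
      LinearMap.ker (LinearMap.lsmul R N t) ≤ LinearMap.ker (LinearMap.lsmul R N t') := by
    rintro t _ ⟨c, rfl⟩ v hv
    simp only [LinearMap.mem_ker, LinearMap.lsmul_apply] at hv ⊢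
    rw [mul_comm, mul_smul, hv, smul_zero]
  have range_ker : ∀ t a : R,
      LinearMap.range (LinearMap.lsmul R N t) ≤ LinearMap.ker (LinearMap.lsmul R N a) ∨
      LinearMap.ker (LinearMap.lsmul R N a) ≤ LinearMap.range (LinearMap.lsmul R N t) := by
    intro t a
    by_cases h : a * t = 0
    · left
      rintro _ ⟨w, rfl⟩
      rw [LinearMap.mem_ker, LinearMap.lsmul_apply, LinearMap.lsmul_apply, smul_smul, h, zero_smul]
    · right
      intro v hv
      obtain ⟨y, hy⟩ := hN a t v h hv
      exact ⟨y, hy.symm⟩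
  rcases hrange a s with h | ⟨t, h⟩ | h <;> rcases hrange a' s' with h' | ⟨t', h'⟩ | h' <;>
    rw [h, h'] <;> try simp only [le_top, true_or, or_true]
  · exact (hd t' t).imp (range_le _ _) (range_le _ _)
  · exact range_ker _ _
  · exact (range_ker _ _).symm
  · exact (hd a a').imp (ker_le _ _) (ker_le _ _)

/-- The cosets are closed, as images of scalars are compact, and finitely many meet because the
submodules form a chain. -/
theorem KernelDivisible.cosetCompact (hd : ∀ a b : R, a ∣ b ∨ b ∣ a) {N : Type v}
    [AddCommGroup N] [Module R N] [TopologicalSpace N] [CompactSpace N] [T2Space N]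
    [IsTopologicalAddGroup N] [ContinuousConstSMul R N] (hN : KernelDivisible R N) :
    CosetCompact R N := by
  intro ι x a s hx
  set V : ι → Submodule R N := fun i => smulColon N (a i) (s i) with hVdef
  have hclosed : ∀ i, IsClosed {v : N | v - x i ∈ V i} := by
    intro i
    have h1 : IsClosed (Set.range fun w : N => s i • w) :=
      (isCompact_range (continuous_const_smul (s i))).isClosed
    have h2 : Continuous fun v : N => a i • (v - x i) := by fun_prop
    convert h1.preimage h2 using 1
    ext v
    simp [hVdef, mem_smulColon, eq_comm]
  have hpair : ∀ i j, x i - x j ∈ V i ⊔ V j := by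
    intro i j
    obtain ⟨v, w, w', h, h'⟩ := hx i j
    have h1 : v - x i ∈ V i := mem_smulColon.mpr ⟨w, h⟩
    have h2 : v - x j ∈ V j := mem_smulColon.mpr ⟨w', h'⟩
    have := sub_mem (Submodule.mem_sup_right (S := V i) h2) (Submodule.mem_sup_left (T := V j) h1)
    rwa [sub_sub_sub_cancel_left] at this
  obtain ⟨v, hv⟩ := CompactSpace.iInter_nonempty hclosed (fun t => by
    rcases t.eq_empty_or_nonempty with rfl | ht
    · exact ⟨0, by simp⟩
    obtain ⟨m, -, h⟩ := exists_common_coset_representative x V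
      (fun i j => hN.smulColon_total hd _ _ _ _) hpair t ht
    exact ⟨x m, Set.mem_iInter₂.mpr h⟩)
  exact ⟨v, fun i => mem_smulColon.mp (Set.mem_iInter.mp hv i)⟩

end Criteria

/-! ### Compact duals and a pure embedding of the ring. -/

section CircleDual

theorem AddMonoidHom.exists_comp_eq_of_ker_le {A B C : Type*} [AddCommGroup A] [AddCommGroup B]
    [AddCommGroup C] (hC : Module.Baer ℤ C) (φ : A →+ B) (f : A →+ C) (h : φ.ker ≤ f.ker) :
    ∃ g : B →+ C, g.comp φ = f := by
  obtain ⟨g, hg⟩ := hC.extension_property_addMonoidHom (QuotientAddGroup.kerLift φ)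
    (QuotientAddGroup.kerLift_injective φ) (QuotientAddGroup.lift φ.ker f h)
  refine ⟨g, ?_⟩
  ext a
  exact DFunLike.congr_fun hg (a : A ⧸ φ.ker)

/-- The group of characters of `D` with values in the circle `ℝ ⧸ ℤ`. -/
def CircleDual (D : Type u) [AddCommGroup D] : Type u := D →+ UnitAddCircle

namespace CircleDual

variable {D : Type u} [AddCommGroup D]

instance : AddCommGroup (CircleDual D) := inferInstanceAs (AddCommGroup (D →+ UnitAddCircle))

instance : FunLike (CircleDual D) D UnitAddCircle :=
  inferInstanceAs (FunLike (D →+ UnitAddCircle) D UnitAddCircle)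

instance : AddMonoidHomClass (CircleDual D) D UnitAddCircle :=
  inferInstanceAs (AddMonoidHomClass (D →+ UnitAddCircle) D UnitAddCircle)

instance (R : Type v) [CommRing R] [Module R D] : Module R (CircleDual D) where
  smul r f := AddMonoidHom.comp (f : D →+ UnitAddCircle) (DistribSMul.toAddMonoidHom D r)
  one_smul f := DFunLike.ext _ _ fun d => congrArg f (one_smul R d)
  mul_smul r s f := DFunLike.ext _ _ fun d => congrArg f (by
    change (r * s) • d = s • r • d
    rw [mul_comm, mul_smul])
  smul_zero _ := rfl
  smul_add _ _ _ := rfl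
  add_smul r s f := DFunLike.ext _ _ fun d =>
    (congrArg f (add_smul r s d)).trans (map_add f _ _)
  zero_smul f := DFunLike.ext _ _ fun d => (congrArg f (zero_smul R d)).trans (map_zero f)

theorem smul_apply {R : Type v} [CommRing R] [Module R D] (r : R) (f : CircleDual D) (d : D) :
    (r • f) d = f (r • d) := rfl

instance : TopologicalSpace (CircleDual D) :=
  TopologicalSpace.induced (fun f => (f : D → UnitAddCircle)) inferInstance

/-- Additivity is a closed condition in the product of circles; compactness then follows from
Tychonoff's theorem. -/
theorem isClosedEmbedding_coe :
    Topology.IsClosedEmbedding (fun f : CircleDual D => (f : D → UnitAddCircle)) where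
  eq_induced := rfl
  injective := DFunLike.coe_injective
  isClosed_range := AddMonoidHom.isClosed_range_coe D UnitAddCircle

instance : CompactSpace (CircleDual D) := isClosedEmbedding_coe.compactSpace

instance : T2Space (CircleDual D) := isClosedEmbedding_coe.isEmbedding.t2Space

theorem continuous_apply_const (d : D) : Continuous fun f : CircleDual D => f d :=
  (continuous_apply d).comp isClosedEmbedding_coe.continuous

theorem continuous_iff {X : Type*} [TopologicalSpace X] {φ : X → CircleDual D} :
    Continuous φ ↔ ∀ d, Continuous fun x => φ x d :=
  isClosedEmbedding_coe.isInducing.continuous_iff.trans continuous_pi_iff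

instance : IsTopologicalAddGroup (CircleDual D) where
  continuous_add := continuous_iff.mpr fun d =>
    ((continuous_apply_const d).comp continuous_fst).add
      ((continuous_apply_const d).comp continuous_snd)
  continuous_neg := continuous_iff.mpr fun d => (continuous_apply_const d).neg

instance (R : Type v) [CommRing R] [Module R D] : ContinuousConstSMul R (CircleDual D) where
  continuous_const_smul r := continuous_iff.mpr fun d => continuous_apply_const (r • d)

end CircleDual

/-- Duality exchanges `t` and `r`: if `t • f = 0` then `f` vanishes on `t • A`, which contains the
kernel of `r`, so `f` factors through multiplication by `r`. -/
theorem KernelDivisible.characterModule {R : Type u} [CommRing R] {A : Type v} [AddCommGroup A]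
    [Module R A] (hA : KernelDivisible R A) : KernelDivisible R (CharacterModule A) := by
  intro t r f htr htf
  obtain ⟨g, hg⟩ := AddMonoidHom.exists_comp_eq_of_ker_le (Module.Baer.of_divisible _)
    (DistribSMul.toAddMonoidHom A r) f (fun a ha => by
      obtain ⟨b, rfl⟩ := hA r t a (by rwa [mul_comm]) ha
      exact DFunLike.congr_fun htf b)
  exact ⟨g, hg.symm⟩

theorem KernelDivisible.circleDual {R : Type u} [CommRing R] {A : Type v} [AddCommGroup A]
    [Module R A] (hA : KernelDivisible R A) : KernelDivisible R (CircleDual A) := by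
  intro t r f htr htf
  obtain ⟨g, hg⟩ := AddMonoidHom.exists_comp_eq_of_ker_le (Module.Baer.of_divisible _)
    (DistribSMul.toAddMonoidHom A r) f (fun a ha => by
      obtain ⟨b, rfl⟩ := hA r t a (by rwa [mul_comm]) ha
      exact DFunLike.congr_fun htf b)
  exact ⟨g, hg.symm⟩

/-- Characters take values in `ℚ ⧸ ℤ`, whereas the outer dual needs the compact circle; this makes
evaluation at `1` an element of the outer dual. -/
theorem exists_injective_addCircle_rat : ∃ ι : AddCircle (1 : ℚ) →+ UnitAddCircle,
    Function.Injective ι := by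
  let c : ℚ →+ ℝ := (Rat.castHom ℝ).toAddMonoidHom
  refine ⟨QuotientAddGroup.lift _ ((QuotientAddGroup.mk' _).comp c) ?_, ?_⟩
  · intro x hx
    obtain ⟨n, rfl⟩ := AddSubgroup.mem_zmultiples_iff.mp hx
    refine (QuotientAddGroup.eq_zero_iff _).mpr (AddSubgroup.mem_zmultiples_iff.mpr ⟨n, ?_⟩)
    simp [c]
  · rw [injective_iff_map_eq_zero]
    intro x
    induction x using QuotientAddGroup.induction_on with
    | H x =>
      intro hx
      obtain ⟨n, hn⟩ := AddSubgroup.mem_zmultiples_iff.mp ((QuotientAddGroup.eq_zero_iff _).mp hx)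
      refine (QuotientAddGroup.eq_zero_iff _).mpr (AddSubgroup.mem_zmultiples_iff.mpr ⟨n, ?_⟩)
      have hn' : ((n : ℤ) : ℝ) = (x : ℝ) := by simpa [c] using hn
      simpa using (by exact_mod_cast hn' : (n : ℚ) = x)

/-- Divisibility of multiples of `e` is the same in `M` as in `R`: the map `r ↦ r • e` is a pure
embedding. -/
def IsPureElement (R : Type u) {M : Type v} [CommRing R] [AddCommGroup M] [Module R M] (e : M) :
    Prop :=
  ∀ (r s : R) (m : M), r • e = s • m → s ∣ r

/-- The ring embeds purely into a compact Hausdorff module. -/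
theorem exists_isPureElement_circleDual (R : Type u) [CommRing R] :
    ∃ e : CircleDual (CharacterModule R), IsPureElement R e := by
  obtain ⟨ι, hι⟩ := exists_injective_addCircle_rat
  let ev : CharacterModule R →+ AddCircle (1 : ℚ) :=
    { toFun := fun f => f 1
      map_zero' := rfl
      map_add' := fun _ _ => rfl }
  let e : CircleDual (CharacterModule R) := ι.comp ev
  refine ⟨e, fun r s n h => ?_⟩
  by_contra hsr
  -- A character of `R ⧸ (s)` that is non-zero at `r` gives an `f` with `s • f = 0`: multiples of
  -- `s` vanish at `f`, but `r • e` does not.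
  obtain ⟨c, hc⟩ := CharacterModule.exists_character_apply_ne_zero_of_ne_zero
    (a := Ideal.Quotient.mk (Ideal.span {s}) r)
    (by rwa [Ne, Ideal.Quotient.eq_zero_iff_mem, Ideal.mem_span_singleton])
  let f : CharacterModule R :=
    AddMonoidHom.comp c (Ideal.Quotient.mk (Ideal.span {s})).toAddMonoidHom
  have hsf : s • f = 0 := by
    ext a
    have : Ideal.Quotient.mk (Ideal.span {s}) (s • a) = 0 := by
      rw [Ideal.Quotient.eq_zero_iff_mem, Ideal.mem_span_singleton]
      exact dvd_mul_right s a
    exact (congrArg c this).trans (map_zero c)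
  have h1 : (r • e) f = ι (c (Ideal.Quotient.mk _ r)) := by
    change ι (c (Ideal.Quotient.mk _ (r • 1))) = _
    rw [smul_eq_mul, mul_one]
  have h2 : (s • n) f = 0 := by rw [CircleDual.smul_apply, hsf, map_zero]
  rw [h, h2] at h1
  exact hc (hι (by rw [← h1, map_zero]))

end CircleDual

/-! ### Flat, content and singly projective modules in terms of factorizations. -/

section Elementwise

variable {R : Type u} [CommRing R] {M : Type v} [AddCommGroup M] [Module R M]

/-- Every element killed by `s` is a multiple by an element of the annihilator of `s`; over a
valuation ring this is flatness. -/
def AnnihilatorDivisible (R : Type u) (M : Type v) [CommRing R] [AddCommGroup M] [Module R M] :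
    Prop :=
  ∀ (s : R) (m : M), s • m = 0 → ∃ (k : R) (n : M), k * s = 0 ∧ m = k • n

/-- Every element has a most divisible factor; over a valuation ring this means being a content
module. -/
def HasContentFactors (R : Type u) (M : Type v) [CommRing R] [AddCommGroup M] [Module R M] :
    Prop :=
  ∀ x : M, ∃ (r : R) (w : M), x = r • w ∧ ∀ (s : R) (m : M), x = s • m → s ∣ r

/-- Every element is a multiple by a scalar having the same annihilator; over a valuation ring this
means being singly projective. -/
def HasAnnihilatorFactors (R : Type u) (M : Type v) [CommRing R] [AddCommGroup M] [Module R M] :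
    Prop :=
  ∀ x : M, ∃ (r : R) (w : M), x = r • w ∧ ∀ s : R, s • x = 0 → s * r = 0

theorem annihilatorDivisible_of_flat (hd : ∀ a b : R, a ∣ b ∨ b ∣ a) [Module.Flat R M] :
    AnnihilatorDivisible R M := by
  intro s m hsm
  have := Module.Flat.isTrivialRelation_of_sum_smul_eq_zero (R := R) (M := M)
    (ι := Unit) (f := fun _ => s) (x := fun _ => m) (by simpa using hsm)
  obtain ⟨κ, a, y, h, h'⟩ := this
  have hm : m = ∑ j, a () j • y j := h ()
  rcases exists_sum_smul_eq_smul hd Finset.univ (fun j => a () j) y with h0 | ⟨j, -, w, hw⟩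
  · exact ⟨0, 0, by simp, by rw [hm, h0, smul_zero]⟩
  · exact ⟨a () j, w, by simpa [mul_comm] using h' j, by rw [hm, hw]⟩

/-- Finitely generated ideals are principal, so every tensor is `s ⊗ m`. If `s • m = 0`, write `m =
k • n` with `k * s = 0` and move `k` across. -/
theorem AnnihilatorDivisible.flat (hd : ∀ a b : R, a ∣ b ∨ b ∣ a)
    (hM : AnnihilatorDivisible R M) : Module.Flat R M := by
  open TensorProduct in
  rw [Module.Flat.iff_lift_lsmul_comp_subtype_injective]
  intro I hI
  obtain ⟨s, rfl⟩ : ∃ s, I = Ideal.span {s} := by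
    induction I, hI using Submodule.fg_induction with
    | singleton x => exact ⟨x, rfl⟩
    | sup I J hI hJ hI' hJ' =>
      obtain ⟨a, rfl⟩ := hI'
      obtain ⟨b, rfl⟩ := hJ'
      rcases hd a b with h | h
      · exact ⟨a, sup_eq_left.mpr (Ideal.span_singleton_le_span_singleton.mpr h)⟩
      · exact ⟨b, sup_eq_right.mpr (Ideal.span_singleton_le_span_singleton.mpr h)⟩
  rw [injective_iff_map_eq_zero]
  intro z hz
  let s' : Ideal.span {s} := ⟨s, Ideal.mem_span_singleton_self s⟩
  obtain ⟨m, rfl⟩ : ∃ m : M, z = s' ⊗ₜ[R] m := by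
    clear hz
    induction z using TensorProduct.induction_on with
    | zero => exact ⟨0, by simp⟩
    | tmul x y =>
      obtain ⟨x, hx⟩ := x
      obtain ⟨c, rfl⟩ := Ideal.mem_span_singleton'.mp hx
      exact ⟨c • y, by rw [TensorProduct.tmul_smul]; rfl⟩
    | add x y hx hy =>
      obtain ⟨m, rfl⟩ := hx
      obtain ⟨n, rfl⟩ := hy
      exact ⟨m + n, (TensorProduct.tmul_add _ _ _).symm⟩
  rw [TensorProduct.lift.tmul] at hz
  obtain ⟨k, n, hk, rfl⟩ := hM s m hz
  rw [TensorProduct.tmul_smul, TensorProduct.smul_tmul',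
    show k • s' = 0 from Subtype.ext hk, TensorProduct.zero_tmul]

theorem exists_eq_smul_of_mem_smul_top (hd : ∀ a b : R, a ∣ b ∨ b ∣ a) {A : Ideal R} {x : M}
    (hx : x ∈ A • (⊤ : Submodule R M)) : ∃ a ∈ A, ∃ m : M, x = a • m := by
  induction hx using Submodule.smul_induction_on' with
  | smul r hr n hn => exact ⟨r, hr, n, rfl⟩
  | add x hx y hy ihx ihy =>
    obtain ⟨a, ha, m, rfl⟩ := ihx
    obtain ⟨b, hb, n, rfl⟩ := ihy
    obtain ⟨c, w, rfl | rfl, h⟩ := exists_add_smul_eq_smul hd a b m n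
    · exact ⟨_, ha, w, h⟩
    · exact ⟨_, hb, w, h⟩

/-- Elements of `A M` are single multiples `a • m` with `a ∈ A`. A scalar `r` dividing `x` is thus
most divisible exactly when it lies in the content ideal of `x`. -/
theorem isContentModule_iff_hasContentFactors (hd : ∀ a b : R, a ∣ b ∨ b ∣ a) :
    IsContentModule R M ↔ HasContentFactors R M := by
  refine forall_congr' fun x => ⟨fun h => ?_, ?_⟩
  · obtain ⟨r, hr, w, hw⟩ := exists_eq_smul_of_mem_smul_top hd h
    refine ⟨r, w, hw, fun s m hs => Ideal.mem_span_singleton.mp ((Submodule.mem_sInf.mp hr) _ ?_)⟩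
    change x ∈ Ideal.span {s} • (⊤ : Submodule R M)
    rw [hs]
    exact Submodule.smul_mem_smul (Ideal.mem_span_singleton_self s) trivial
  · rintro ⟨r, w, hw, h⟩
    have hr : r ∈ moduleContentIdeal R x := Submodule.mem_sInf.mpr fun A hA => by
      obtain ⟨a, ha, m, hm⟩ := exists_eq_smul_of_mem_smul_top hd (show x ∈ A • ⊤ from hA)
      obtain ⟨c, rfl⟩ := h a m hm
      exact Ideal.mul_mem_right c A ha
    have := Submodule.smul_mem_smul hr (Submodule.mem_top (x := w))
    rwa [← hw] at this

/-- In a flat content module each non-zero element is a multiple of one which is not divisible by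
any non-unit. -/
theorem HasContentFactors.exists_eq_smul (hd : ∀ a b : R, a ∣ b ∨ b ∣ a)
    (hc : HasContentFactors R M) {x : M} (hx : x ≠ 0) :
    ∃ (r : R) (w : M), x = r • w ∧ ∀ (p : R) (m : M), w = p • m → IsUnit p := by
  obtain ⟨r, w, hw, h⟩ := hc x
  refine ⟨r, w, hw, fun p m hp => ?_⟩
  by_contra hpu
  have := h (r * p) m (by rw [hw, hp, smul_smul])
  refine hx ?_
  rw [hw, eq_zero_of_mul_dvd hd hpu this, zero_smul]

theorem AnnihilatorDivisible.smul_eq_zero_iff (ha : AnnihilatorDivisible R M) {w : M}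
    (hw : ∀ (p : R) (m : M), w = p • m → IsUnit p) {s : R} (hs : s • w = 0) : s = 0 := by
  obtain ⟨k, n, hk, hn⟩ := ha s w hs
  exact (hw k n hn).mul_right_eq_zero.mp hk

theorem HasContentFactors.hasAnnihilatorFactors (hd : ∀ a b : R, a ∣ b ∨ b ∣ a)
    (hc : HasContentFactors R M) (ha : AnnihilatorDivisible R M) : HasAnnihilatorFactors R M := by
  intro x
  by_cases hx : x = 0
  · exact ⟨0, 0, by simp [hx], by simp⟩
  obtain ⟨r, w, hw, h⟩ := hc.exists_eq_smul hd hx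
  exact ⟨r, w, hw, fun s hs => ha.smul_eq_zero_iff h (by rw [mul_smul, ← hw, hs])⟩

theorem HasAnnihilatorFactors.annihilatorDivisible (h : HasAnnihilatorFactors R M) :
    AnnihilatorDivisible R M := by
  intro s m hsm
  obtain ⟨r, w, hw, hr⟩ := h m
  exact ⟨r, w, by rw [mul_comm, hr s hsm], hw⟩

/-- The given factor `w` works. If `s • w = 0` and `s ∣ r` then `x = 0`; if `s = r * t` then `t • x
= 0`, so `t * r = 0`. -/
theorem HasAnnihilatorFactors.exists_eq_smul (hd : ∀ a b : R, a ∣ b ∨ b ∣ a)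
    (h : HasAnnihilatorFactors R M) {x : M} (hx : x ≠ 0) :
    ∃ (r : R) (w : M), x = r • w ∧ ∀ s : R, s • w = 0 → s = 0 := by
  obtain ⟨r, w, hw, hr⟩ := h x
  refine ⟨r, w, hw, fun s hs => ?_⟩
  rcases hd s r with ⟨t, rfl⟩ | ⟨t, rfl⟩
  · exact absurd (by rw [hw, mul_comm, mul_smul, hs, smul_zero]) hx
  · have := hr t (by rw [hw, smul_smul, mul_comm, hs])
    rwa [mul_comm]

section Retract

variable {M' : Type*} [AddCommGroup M'] [Module R M'] (i : M' →ₗ[R] M) (p : M →ₗ[R] M')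

theorem AnnihilatorDivisible.of_retract (hip : ∀ x, p (i x) = x) (h : AnnihilatorDivisible R M) :
    AnnihilatorDivisible R M' := by
  intro s m hs
  obtain ⟨k, n, hk, hn⟩ := h s (i m) (by rw [← map_smul, hs, map_zero])
  exact ⟨k, p n, hk, by rw [← map_smul, ← hn, hip]⟩

theorem HasContentFactors.of_retract (hip : ∀ x, p (i x) = x) (h : HasContentFactors R M) :
    HasContentFactors R M' := by
  intro x
  obtain ⟨r, w, hw, hr⟩ := h (i x)
  exact ⟨r, p w, by rw [← map_smul, ← hw, hip], fun s m hs => hr s (i m) (by rw [hs, map_smul])⟩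

theorem HasAnnihilatorFactors.of_retract (hip : ∀ x, p (i x) = x)
    (h : HasAnnihilatorFactors R M) : HasAnnihilatorFactors R M' := by
  intro x
  obtain ⟨r, w, hw, hr⟩ := h (i x)
  exact ⟨r, p w, by rw [← map_smul, ← hw, hip],
    fun s hs => hr s (by rw [← map_smul, hs, map_zero])⟩

end Retract

/-- A non-zero element of a free module has a coordinate of which it is a multiple. -/
theorem exists_repr_factor (hd : ∀ a b : R, a ∣ b ∨ b ∣ a) {κ : Type*} (b : Module.Basis κ R M)
    (x : M) : x = 0 ∨ ∃ (j : κ) (w : M), x = b.repr x j • w := by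
  have hx : ∑ i ∈ (b.repr x).support, b.repr x i • b i = x := b.linearCombination_repr x
  rcases exists_sum_smul_eq_smul hd (b.repr x).support (b.repr x) b with h | ⟨j, -, w, h⟩
  · exact Or.inl (by rw [← hx, h])
  · exact Or.inr ⟨j, w, by rw [← h, hx]⟩

/-- For `r` take a coordinate that divides the image of `x` in the free module. Conversely `x ↦ r`
and `1 ↦ w` factor the inclusion through `R` itself. -/
theorem isSinglyProjective_iff_hasAnnihilatorFactors {M : Type u} [AddCommGroup M] [Module R M]
    (hd : ∀ a b : R, a ∣ b ∨ b ∣ a) : IsSinglyProjective R M ↔ HasAnnihilatorFactors R M := by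
  refine forall_congr' fun x => ⟨?_, ?_⟩
  · rintro ⟨F, _, _, _, φ, π, h⟩
    let x' : Submodule.span R {x} := ⟨x, Submodule.mem_span_singleton_self x⟩
    have hx' : π (φ x') = x := LinearMap.congr_fun h x'
    rcases exists_repr_factor hd (Module.Free.chooseBasis R F) (φ x') with h0 | ⟨j, w, hw⟩
    · exact ⟨0, 0, by rw [← hx', h0, map_zero, smul_zero], by simp⟩
    · refine ⟨_, π w, by rw [← map_smul, ← hw, hx'], fun s hs => ?_⟩
      have : s • φ x' = 0 := by
        rw [← map_smul, show s • x' = 0 from Subtype.ext hs, map_zero]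
      have := congrArg (fun z => (Module.Free.chooseBasis R F).repr z j) this
      simpa using this
  · rintro ⟨r, w, hw, hr⟩
    let f : M →ₗ.[R] R := LinearPMap.mkSpanSingleton' (σ := RingHom.id R) x r
      (fun c hc => hr c hc)
    refine ⟨R, inferInstance, inferInstance, inferInstance, f.toFun,
      LinearMap.toSpanSingleton R M w, ?_⟩
    ext ⟨z, hz⟩
    obtain ⟨c, rfl⟩ := Submodule.mem_span_singleton.mp hz
    have : f.toFun ⟨c • x, hz⟩ = c • r :=
      LinearPMap.mkSpanSingleton'_apply (σ := RingHom.id R) x r _ c hz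
    change f.toFun ⟨c • x, hz⟩ • w = c • x
    rw [this, hw, smul_smul, smul_eq_mul]

end Elementwise

/-! ### A flat content hull of the ring and the reduction of maximality to a retraction. -/

section Hull

variable {R : Type u} [CommRing R]

/-- If some endomorphism of a compact module fixes `e` and kills `K`, then some idempotent
endomorphism does so too (Ellis' lemma). -/
theorem exists_idempotent_endomorphism {N : Type v} [AddCommGroup N] [Module R N]
    [TopologicalSpace N] [CompactSpace N] [T2Space N] [IsTopologicalAddGroup N]
    [ContinuousConstSMul R N] (e : N) (K : Submodule R N)
    (h : ∃ g : N →ₗ[R] N, g e = e ∧ ∀ k ∈ K, g k = 0) :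
    ∃ g : N →ₗ[R] N, g e = e ∧ (∀ k ∈ K, g k = 0) ∧ ∀ x, g (g x) = g x := by
  let _ : TopologicalSpace (Function.End N) := inferInstanceAs (TopologicalSpace (N → N))
  have : T2Space (Function.End N) := inferInstanceAs (T2Space (N → N))
  have : CompactSpace (Function.End N) := inferInstanceAs (CompactSpace (N → N))
  have hev : ∀ x : N, Continuous fun f : Function.End N => f x := fun x =>
    continuous_apply (A := fun _ : N => N) x
  let S : Set (Function.End N) := {f | (∀ x y, f (x + y) = f x + f y) ∧
    (∀ (r : R) x, f (r • x) = r • f x) ∧ f e = e ∧ ∀ k ∈ K, f k = 0}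
  have hS : IsClosed S := by
    have : S = (⋂ (x : N) (y : N), {f | f (x + y) = f x + f y}) ∩
        ((⋂ (r : R) (x : N), {f | f (r • x) = r • f x}) ∩
          ({f | f e = e} ∩ ⋂ k ∈ K, {f | f k = 0})) := by
      ext f
      simp only [S, Set.mem_inter_iff, Set.mem_iInter]
      rfl
    rw [this]
    exact (isClosed_iInter fun x => isClosed_iInter fun y =>
        isClosed_eq (hev _) ((hev _).add (hev _))).inter <|
      (isClosed_iInter fun r => isClosed_iInter fun x =>
        isClosed_eq (hev _) ((hev _).const_smul r)).inter <|
      (isClosed_eq (hev _) continuous_const).inter <|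
      isClosed_iInter fun k => isClosed_iInter fun _ => isClosed_eq (hev _) continuous_const
  -- Only `f ↦ f ∘ r` has to be continuous, which holds for pointwise convergence even if `r` is not
  -- continuous.
  obtain ⟨f, ⟨hadd, hsmul, hfe, hfK⟩, hff⟩ := exists_idempotent_in_compact_subsemigroup
    (M := Function.End N) (fun r => continuous_pi fun x => hev (r x)) S
    (by
      obtain ⟨g, hge, hgK⟩ := h
      exact ⟨(g : N → N), map_add g, map_smul g, hge, hgK⟩) hS.isCompact (by
      rintro f ⟨h1, h2, h3, h4⟩ g ⟨h1', h2', h3', h4'⟩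
      refine ⟨fun x y => ?_, fun r x => ?_, ?_, fun k hk => ?_⟩
      · change f (g (x + y)) = f (g x) + f (g y)
        rw [h1', h1]
      · change f (g (r • x)) = r • f (g x)
        rw [h2', h2]
      · change f (g e) = e
        rw [h3', h3]
      · change f (g k) = 0
        rw [h4' k hk, h4 0 K.zero_mem])
  exact ⟨{ toFun := f, map_add' := hadd, map_smul' := hsmul }, hfe, hfK,
    fun x => congrFun hff x⟩

/-- The image of `e` modulo `K` is a pure element. -/
def IsPureModulo {N : Type v} [AddCommGroup N] [Module R N] (e : N) (K : Submodule R N) : Prop :=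
  ∀ (c s : R) (z : N), c • e - s • z ∈ K → s ∣ c

theorem IsPureElement.exists_maximal_isPureModulo {N : Type v} [AddCommGroup N] [Module R N]
    {e : N} (he : IsPureElement R e) : ∃ K : Submodule R N, Maximal (IsPureModulo e) K := by
  obtain ⟨K, -, hK⟩ := zorn_le_nonempty₀ {K : Submodule R N | IsPureModulo e K}
    (fun C hC hch K hK => by
      refine ⟨sSup C, fun c s z h => ?_, fun L hL => le_sSup hL⟩
      obtain ⟨L, hL, h⟩ := (Submodule.mem_sSup_of_directed ⟨K, hK⟩ hch.directedOn).mp h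
      exact hC hL c s z h) ⊥
    (fun c s z h => he c s z (sub_eq_zero.mp ((Submodule.mem_bot R).mp h)))
  exact ⟨K, hK⟩

/-- Purity modulo `K` says that sending the class of `e` back to `e` preserves divisibility, so this
map extends to `N ⧸ K`. -/
theorem IsPureModulo.exists_endomorphism (hd : ∀ a b : R, a ∣ b ∨ b ∣ a) {N : Type u}
    [AddCommGroup N] [Module R N] (hN : CosetCompact R N) {e : N} {K : Submodule R N}
    (hK : IsPureModulo e K) : ∃ g : N →ₗ[R] N, g e = e ∧ ∀ k ∈ K, g k = 0 := by
  have hpure : ∀ (c s : R) (y : N ⧸ K), c • K.mkQ e = s • y → s ∣ c := by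
    intro c s y h
    obtain ⟨z, rfl⟩ := K.mkQ_surjective y
    exact hK c s z ((Submodule.Quotient.eq K).mp h)
  let f : (N ⧸ K) →ₗ.[R] N := LinearPMap.mkSpanSingleton' (σ := RingHom.id R) (K.mkQ e) e
    (fun c hc => by
      have := hpure c 0 0 (by rw [hc, smul_zero])
      rw [zero_dvd_iff.mp this]
      exact zero_smul R e)
  obtain ⟨g, hg⟩ := LinearPMap.PreservesDivisibility.exists_extension hd hN (f := f) (by
    rintro ⟨z, hz⟩ s m h
    obtain ⟨c, rfl⟩ := Submodule.mem_span_singleton.mp hz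
    obtain ⟨d, rfl⟩ := hpure c s m h
    refine ⟨d • e, ?_⟩
    rw [smul_smul]
    exact LinearPMap.mkSpanSingleton'_apply (σ := RingHom.id R) _ _ _ _ hz)
  refine ⟨g ∘ₗ K.mkQ, ?_, fun k hk => ?_⟩
  · have hmem : (1 : R) • K.mkQ e ∈ f.domain := by
      rw [one_smul]
      exact Submodule.mem_span_singleton_self (K.mkQ e)
    have h1 := hg ⟨_, hmem⟩
    have h2 : f ⟨_, hmem⟩ = (1 : R) • e :=
      LinearPMap.mkSpanSingleton'_apply (σ := RingHom.id R) _ _ _ _ hmem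
    rw [h2] at h1
    simpa using h1
  · rw [LinearMap.comp_apply, Submodule.mkQ_apply, (Submodule.Quotient.mk_eq_zero K).mpr hk,
      map_zero]

/-- If the kernel of an idempotent is maximal among the submodules modulo which `e` is pure, then
each non-zero element of its image is a multiple of an element that agrees with `e` up to a
non-unit multiple, after multiplication by a non-zero scalar. -/
theorem KernelDivisible.exists_factor_of_maximal (hd : ∀ a b : R, a ∣ b ∨ b ∣ a) {N : Type v}
    [AddCommGroup N] [Module R N] (hN : KernelDivisible R N) {e : N} {g : N →ₗ[R] N}
    (hge : g e = e) (hmax : Maximal (IsPureModulo e) (LinearMap.ker g))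
    {y : N} (hy : g y = y) (hy0 : y ≠ 0) :
    ∃ (t r q : R) (w z : N), t * r ≠ 0 ∧ ¬ IsUnit q ∧ y = r • g w ∧
      t • y = (t * r) • (e - q • z) := by
  have hpure : ∀ (c s : R) (z : N), c • e = s • z → s ∣ c := fun c s z h =>
    hmax.1 c s z (by rw [h, sub_self]; exact zero_mem _)
  -- Since `g y = y ≠ 0`, adjoining `y` strictly enlarges the kernel and must destroy purity;
  -- applying `g` to the witness gives `hty`.
  have hKy : ¬ IsPureModulo e (LinearMap.ker g ⊔ R ∙ y) := fun h => by
    have := hmax.2 h le_sup_left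
      (Submodule.mem_sup_right (Submodule.mem_span_singleton_self y))
    rw [LinearMap.mem_ker, hy] at this
    exact hy0 this
  simp only [IsPureModulo, not_forall] at hKy
  obtain ⟨c, s, z, hmem, hsc⟩ := hKy
  obtain ⟨k, hk, l, hl, hkl⟩ := Submodule.mem_sup.mp hmem
  obtain ⟨t, rfl⟩ := Submodule.mem_span_singleton.mp hl
  obtain ⟨q, hq, rfl⟩ := exists_eq_mul_of_not_dvd hd hsc
  have hty : t • y = c • (e - q • g z) := by
    have := congrArg g hkl
    rw [map_add, LinearMap.mem_ker.mp hk, zero_add, map_smul, hy, map_sub, map_smul, map_smul,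
      hge] at this
    rw [this, smul_sub, smul_smul]
  have hc : c ≠ 0 := by
    rintro rfl
    exact hsc (dvd_zero _)
  -- Otherwise `t` is a non-unit multiple of `c`, and `hty` exhibits `c • e` as divisible by `c * p`
  -- with `p` a non-unit, against purity.
  obtain ⟨r, rfl⟩ : t ∣ c := by
    by_contra h
    obtain ⟨q', hq', rfl⟩ := exists_eq_mul_of_not_dvd hd h
    obtain ⟨p, w, hp, hw⟩ := exists_add_smul_eq_smul hd q' q y (g z)
    have hp' : ¬ IsUnit p := by rcases hp with rfl | rfl <;> assumption
    refine hc (eq_zero_of_mul_dvd hd hp' (hpure c (c * p) w ?_))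
    rw [mul_smul c p, ← hw, smul_add, smul_smul, hty, smul_sub, sub_add_cancel]
  obtain ⟨w, hw⟩ := hN t r (y - r • (e - q • g z)) hc (by
    rw [smul_sub, hty, smul_smul, sub_self])
  refine ⟨t, r, q, w + (e - q • g z), g z, hc, hq, ?_, hty⟩
  rw [← map_smul, smul_add, ← hw, sub_add_cancel, hy]

/-- A pure extension of the ring by a flat content module containing limits of all families of
principal cosets. -/
theorem exists_flat_content_extension (hd : ∀ a b : R, a ∣ b ∨ b ∣ a) :
    ∃ (Y : Type u) (_ : AddCommGroup Y) (_ : Module R Y) (e : Y),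
      AnnihilatorDivisible R Y ∧ HasContentFactors R Y ∧ IsPureElement R e ∧
      ∀ (ι : Type u) (a s : ι → R), (∀ i j, ∃ c : R, s i ∣ c - a i ∧ s j ∣ c - a j) →
        ∃ x : Y, ∀ i, ∃ y : Y, x - a i • e = s i • y := by
  obtain ⟨e, he⟩ := exists_isPureElement_circleDual R
  have hN : KernelDivisible R (CircleDual (CharacterModule R)) :=
    (kernelDivisible_self hd).characterModule.circleDual
  have hNc : CosetCompact R (CircleDual (CharacterModule R)) := hN.cosetCompact hd
  obtain ⟨K, hK⟩ := he.exists_maximal_isPureModulo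
  obtain ⟨g, hge, hgK, hgg⟩ := exists_idempotent_endomorphism e K
    (hK.1.exists_endomorphism hd hNc)
  -- As `g` fixes `e`, the element `e` is pure modulo the kernel of `g`, so maximality of `K` forces
  -- equality.
  obtain rfl : K = LinearMap.ker g := le_antisymm hgK (hK.2 (fun c s z h => by
    refine he c s (g z) ?_
    rwa [LinearMap.mem_ker, map_sub, map_smul, map_smul, hge, sub_eq_zero] at h) hgK)
  have hfix : ∀ y ∈ LinearMap.range g, g y = y := by
    rintro _ ⟨x, rfl⟩
    exact hgg x
  refine ⟨LinearMap.range g, inferInstance, inferInstance, ⟨e, e, hge⟩, ?_, ?_, ?_, ?_⟩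
  · rintro s ⟨y, hyr⟩ hs
    have hs : s • y = 0 := congrArg Subtype.val hs
    by_cases hy : y = 0
    · exact ⟨0, 0, by simp, by subst hy; simp⟩
    obtain ⟨t, r, q, w, z, htr, hq, hw, ht⟩ :=
      hN.exists_factor_of_maximal hd hge hK (hfix y hyr) hy
    refine ⟨r, ⟨g w, w, rfl⟩, ?_, Subtype.ext hw⟩
    -- A scalar `c` killing `e - q • z` gives `c • e = (c * q) • z`, hence `c = 0` by purity. This
    -- excludes `s ∣ t` and yields `r * s = 0` when `t ∣ s`.
    rcases hd s t with ⟨d, rfl⟩ | ⟨d, rfl⟩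
    · rw [mul_comm s, mul_smul, hs, smul_zero, eq_comm, smul_sub, sub_eq_zero, smul_smul] at ht
      have := eq_zero_of_mul_dvd hd hq (he _ _ _ ht)
      exact absurd this (by rwa [mul_comm d])
    · rw [mul_comm t, mul_smul, ht, smul_smul, smul_sub, sub_eq_zero, smul_smul] at hs
      rw [← eq_zero_of_mul_dvd hd hq (he _ _ _ hs)]
      ring
  · rintro ⟨y, hyr⟩
    by_cases hy : y = 0
    · exact ⟨0, 0, by subst hy; simp, by simp⟩
    obtain ⟨t, r, q, w, z, htr, hq, hw, ht⟩ :=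
      hN.exists_factor_of_maximal hd hge hK (hfix y hyr) hy
    refine ⟨r, ⟨g w, w, rfl⟩, Subtype.ext hw, ?_⟩
    rintro s ⟨m, hm⟩ hs
    have hs : y = s • m := congrArg Subtype.val hs
    by_contra hsr
    obtain ⟨q', hq', rfl⟩ := exists_eq_mul_of_not_dvd hd hsr
    obtain ⟨p, x, hp, hx⟩ := exists_add_smul_eq_smul hd q' q m z
    have hp' : ¬ IsUnit p := by rcases hp with rfl | rfl <;> assumption
    -- If `s = r * q'`, then `(t * r) • e` is `(t * r) • (q' • m + q • z)`, divisible by `t * r * p`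
    -- with `p` a non-unit.
    refine htr (eq_zero_of_mul_dvd hd hp' (he (t * r) (t * r * p) x ?_))
    have h1 : (t * r) • q' • m = t • y := by rw [hs, smul_smul, smul_smul, mul_assoc]
    rw [mul_smul (t * r) p, ← hx, smul_add, h1, ht, smul_sub, sub_add_cancel]
  · intro r s m h
    exact he r s m (congrArg Subtype.val h)
  · intro ι a s h
    obtain ⟨x, hx⟩ := hNc ι (fun i => a i • e) (fun _ => 1) s (fun i j => by
      obtain ⟨c, ⟨d, hd⟩, ⟨d', hd'⟩⟩ := h i j
      refine ⟨c • e, d • e, d' • e, ?_, ?_⟩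
      · rw [one_smul, ← sub_smul, hd, mul_smul]
      · rw [one_smul, ← sub_smul, hd', mul_smul])
    refine ⟨⟨g x, x, rfl⟩, fun i => ?_⟩
    obtain ⟨w, hw⟩ := hx i
    refine ⟨⟨g w, w, rfl⟩, Subtype.ext ?_⟩
    have := congrArg g hw
    rw [one_smul, map_sub, map_smul, map_smul, hge] at this
    exact this

/-- A ring which is a retract of its pure extensions by flat content modules is maximal. -/
theorem isMaximalValuationRing_of_retraction (hd : ∀ a b : R, a ∣ b ∨ b ∣ a)
    (h : ∀ (Y : Type u) [AddCommGroup Y] [Module R Y] (e : Y), AnnihilatorDivisible R Y →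
      HasContentFactors R Y → IsPureElement R e → ∃ ρ : Y →ₗ[R] R, ρ e = 1) :
    IsMaximalValuationRing R := by
  intro ι a L hfip
  by_cases hmin : ∃ i, ∀ j, L i ≤ L j
  · obtain ⟨i, hi⟩ := hmin
    refine ⟨a i, fun j => ?_⟩
    classical
    obtain ⟨x, hx⟩ := hfip {i, j}
    have h1 := hi j (hx i (by simp))
    have h2 := hx j (by simp)
    simpa using sub_mem h2 h1
  push Not at hmin
  -- With no smallest ideal, `s i ∈ L i` outside `L (j i)` gives `L (j i) ⊆ (s i) ⊆ L i`, so the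
  -- cosets `a (j i) + (s i)` of principal ideals suffice.
  choose j hj using hmin
  choose s hs hsj using fun i => SetLike.not_le_iff_exists.mp (hj i)
  have hLs : ∀ i, ∀ x ∈ L (j i), s i ∣ x := fun i x hx => by
    rcases hd (s i) x with h | ⟨c, hc⟩
    · exact h
    · exact absurd (hc ▸ (L (j i)).mul_mem_right c hx) (hsj i)
  obtain ⟨Y, _, _, e, hY, hYc, he, hlim⟩ := exists_flat_content_extension hd
  obtain ⟨ρ, hρ⟩ := h Y e hY hYc he
  obtain ⟨x, hx⟩ := hlim ι (fun i => a (j i)) s (fun i k => by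
    classical
    obtain ⟨c, hc⟩ := hfip {j i, j k}
    exact ⟨c, hLs i _ (hc (j i) (by simp)), hLs k _ (hc (j k) (by simp))⟩)
  refine ⟨ρ x, fun i => ?_⟩
  obtain ⟨y, hy⟩ := hx i
  have h1 : ρ x - a (j i) ∈ L i := by
    have := congrArg ρ hy
    rw [map_sub, map_smul, map_smul, hρ, smul_eq_mul, mul_one, smul_eq_mul] at this
    rw [this]
    exact (L i).mul_mem_right _ (hs i)
  have h2 : a (j i) - a i ∈ L i := by
    classical
    obtain ⟨c, hc⟩ := hfip {i, j i}
    have h3 : c - a (j i) ∈ L i := by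
      obtain ⟨d, hd⟩ := hLs i _ (hc (j i) (by simp))
      rw [hd]
      exact (L i).mul_mem_right _ (hs i)
    simpa using sub_mem (hc i (by simp)) h3
  simpa using add_mem h1 h2

end Hull

/-! ### Retractions onto the ring from local projectivity and from separability. -/

section Necessity

variable {R : Type u} [CommRing R] {Y : Type u} [AddCommGroup Y] [Module R Y]

/-- Some coordinate of `φ e` divides `φ e`, hence divides `e = π (φ e)`; purity makes it a unit, and
the rescaled coordinate function is the retraction. -/
theorem IsLocallyProjective.exists_retraction (hd : ∀ a b : R, a ∣ b ∨ b ∣ a)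
    (hY : IsLocallyProjective R Y) {e : Y} (he : IsPureElement R e) : ∃ ρ : Y →ₗ[R] R, ρ e = 1 := by
  obtain ⟨F, _, _, _, φ, π, h⟩ := hY (R ∙ e) (Submodule.fg_span_singleton e)
  have hφ : π (φ e) = e := h e (Submodule.mem_span_singleton_self e)
  let b := Module.Free.chooseBasis R F
  rcases exists_repr_factor hd b (φ e) with h0 | ⟨j, w, hw⟩
  -- Here `e = 0`, so purity gives `0 ∣ 1` and the ring is trivial.
  · have h1 : (1 : R) • e = (0 : R) • e := by rw [one_smul, ← hφ, h0, map_zero, smul_zero]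
    exact ⟨0, eq_of_zero_eq_one (zero_dvd_iff.mp (he _ _ _ h1)).symm _ _⟩
  · have h1 : (1 : R) • e = b.repr (φ e) j • π w := by rw [← map_smul, ← hw, hφ, one_smul]
    obtain ⟨c, hc⟩ := he _ _ _ h1
    refine ⟨c • (b.coord j ∘ₗ φ), ?_⟩
    rw [LinearMap.smul_apply, LinearMap.comp_apply, Module.Basis.coord_apply, smul_eq_mul, mul_comm,
      ← hc]

/-- Some component of `e` is divisible by no non-unit, or else `e` would be divisible by one. By
flatness that component has zero annihilator, and it generates its uniserial summand, which is
therefore a copy of `R`. -/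
theorem IsSeparableModule.exists_retraction (hd : ∀ a b : R, a ∣ b ∨ b ∣ a)
    (hY : IsSeparableModule R Y) (hflat : AnnihilatorDivisible R Y) {e : Y}
    (he : IsPureElement R e) : ∃ ρ : Y →ₗ[R] R, ρ e = 1 := by
  obtain ⟨N, heN, ⟨N', hN⟩, n, U, hU, hind, rfl⟩ := hY {e} (Set.finite_singleton e)
  obtain ⟨f, hf, hfe⟩ := (Submodule.mem_iSup_iff_exists_finsupp U e).mp (heN rfl)
  by_cases hk : ∃ k, ∀ (p : R) (m : Y), f k = p • m → IsUnit p
  swap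
  · push Not at hk
    choose p m hpm hp using hk
    have hsum : ∑ i ∈ f.support, p i • m i = e := by
      rw [← hfe, Finsupp.sum]
      exact Finset.sum_congr rfl fun i _ => (hpm i).symm
    rcases exists_sum_smul_eq_smul hd f.support p m with h0 | ⟨j, -, w, hw⟩
    · have h1 : (1 : R) • e = (0 : R) • e := by rw [← hsum, h0, smul_zero, smul_zero]
      exact ⟨0, eq_of_zero_eq_one (zero_dvd_iff.mp (he _ _ _ h1)).symm _ _⟩
    · have h1 : (1 : R) • e = p j • w := by rw [← hw, hsum, one_smul]
      exact absurd (isUnit_of_dvd_one (he _ _ _ h1)) (hp j)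
  obtain ⟨k, hk⟩ := hk
  let V := (⨆ (j) (_ : j ≠ k), U j) ⊔ N'
  have hsplit : U k ⊔ (⨆ (j) (_ : j ≠ k), U j) = ⨆ j, U j := (iSup_split_single U k).symm
  have hV : IsCompl (U k) V := by
    refine ⟨(hind k).disjoint_sup_right_of_disjoint_sup_left (by rw [hsplit]; exact hN.disjoint),
      ?_⟩
    rw [codisjoint_iff, ← sup_assoc, hsplit]
    exact hN.sup_eq_top
  let u : U k := ⟨f k, hf k⟩
  have hproj : (U k).projectionOnto V hV e = u := by
    have h1 : e - f k ∈ V := by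
      refine Submodule.mem_sup_left ?_
      have : e = f k + ∑ i ∈ f.support \ {k}, f i := by
        rw [← hfe, Finsupp.sum]
        by_cases hks : k ∈ f.support
        · rw [Finset.sdiff_singleton_eq_erase, Finset.add_sum_erase _ _ hks]
        · rw [Finset.sdiff_singleton_eq_erase, Finset.erase_eq_of_notMem hks,
            Finsupp.notMem_support_iff.mp hks, zero_add]
      rw [this, add_sub_cancel_left]
      refine Submodule.sum_mem _ fun i hi => ?_
      have hik : i ≠ k := by
        simp only [Finset.mem_sdiff, Finset.mem_singleton] at hi
        exact hi.2
      exact Submodule.mem_iSup_of_mem i (Submodule.mem_iSup_of_mem hik (hf i))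
    have h2 : (U k).projectionOnto V hV (e - f k) = 0 :=
      (Submodule.projectionOnto_apply_eq_zero_iff hV).mpr h1
    rw [map_sub, sub_eq_zero] at h2
    rw [h2, Submodule.projectionOnto_apply_of_mem_left hV (hf k)]
  have hinj : Function.Injective (LinearMap.toSpanSingleton R (U k) u) := by
    rw [injective_iff_map_eq_zero]
    intro s hs
    exact hflat.smul_eq_zero_iff hk (congrArg Subtype.val hs)
  have hsurj : Function.Surjective (LinearMap.toSpanSingleton R (U k) u) := by
    intro v
    rcases hU k (R ∙ v) (R ∙ u) with h | h
    · exact Submodule.mem_span_singleton.mp (h (Submodule.mem_span_singleton_self v))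
    · obtain ⟨c, hc⟩ := Submodule.mem_span_singleton.mp (h (Submodule.mem_span_singleton_self u))
      obtain ⟨d, hd⟩ := (hk c v (congrArg Subtype.val hc).symm).exists_left_inv
      exact ⟨d, by rw [LinearMap.toSpanSingleton_apply, ← hc, smul_smul, hd, one_smul]⟩
  refine ⟨(LinearEquiv.ofBijective _ ⟨hinj, hsurj⟩).symm.toLinearMap ∘ₗ
    (U k).projectionOnto V hV, ?_⟩
  rw [LinearMap.comp_apply, hproj, LinearEquiv.coe_coe, LinearEquiv.symm_apply_eq]
  exact (one_smul R u).symm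

end Necessity

/-! ### Pure uniserial submodules over a maximal ring are direct summands. -/

section Sufficiency

variable {R : Type u} [CommRing R]

theorem IsUniserialModule.of_surjective {M : Type*} {N : Type*} [AddCommGroup M] [Module R M]
    [AddCommGroup N] [Module R N] (hM : IsUniserialModule R M) (f : M →ₗ[R] N)
    (hf : Function.Surjective f) : IsUniserialModule R N := by
  intro A B
  exact (hM (A.comap f) (B.comap f)).imp (Submodule.comap_le_comap_iff_of_surjective hf).mp
    (Submodule.comap_le_comap_iff_of_surjective hf).mp

theorem isUniserialModule_of_forall_mem_span_singleton {M : Type v} [AddCommGroup M] [Module R M]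
    (h : ∀ x y : M, x ∈ R ∙ y ∨ y ∈ R ∙ x) : IsUniserialModule R M := by
  intro A B
  by_contra! hAB
  obtain ⟨⟨x, hxA, hxB⟩, ⟨y, hyB, hyA⟩⟩ := hAB.imp SetLike.not_le_iff_exists.mp
    SetLike.not_le_iff_exists.mp
  rcases h x y with h | h
  · exact hxB ((Submodule.span_singleton_le_iff_mem y B).mpr hyB h)
  · exact hyA ((Submodule.span_singleton_le_iff_mem x A).mpr hxA h)

theorem IsMaximalValuationRing.exists_isCompl (hd : ∀ a b : R, a ∣ b ∨ b ∣ a)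
    (hm : IsMaximalValuationRing R) {M : Type u} [AddCommGroup M] [Module R M] (V : Submodule R M)
    (hV : IsUniserialModule R V)
    (hpure : ∀ z ∈ V, ∀ (s : R) (m : M), z = s • m → ∃ w ∈ V, z = s • w) :
    ∃ W, IsCompl V W := by
  obtain ⟨g, hg⟩ := exists_retraction_of_pure hd V
    (hm.cosetCompact_of_isUniserialModule hV) hpure
  exact ⟨_, LinearMap.isCompl_of_proj hg⟩

/-- In a flat content module over a maximal valuation ring each element lies in a free direct
summand. -/
theorem HasContentFactors.exists_free_summand (hR : IsUniserialValuationRing R)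
    (hm : IsMaximalValuationRing R) {M : Type u} [AddCommGroup M] [Module R M]
    (hc : HasContentFactors R M) (ha : AnnihilatorDivisible R M) (x : M) :
    ∃ U V : Submodule R M, Module.Free R U ∧ x ∈ U ∧ IsCompl U V := by
  have hd := hR.dvd_total
  by_cases hx : x = 0
  · exact ⟨⊥, ⊤, inferInstance, by simp [hx], isCompl_bot_top⟩
  obtain ⟨r, w, hw, hwp⟩ := hc.exists_eq_smul hd hx
  obtain ⟨V, hV⟩ := hm.exists_isCompl hd (R ∙ w)
    (IsUniserialModule.of_surjective hR
      ((LinearMap.toSpanSingleton R M w).codRestrict (R ∙ w)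
        fun c => Submodule.mem_span_singleton.mpr ⟨c, rfl⟩) (by
        rintro ⟨z, hz⟩
        obtain ⟨c, rfl⟩ := Submodule.mem_span_singleton.mp hz
        exact ⟨c, rfl⟩)) (by
      rintro z hz s m hzm
      obtain ⟨a, rfl⟩ := Submodule.mem_span_singleton.mp hz
      rcases hd s a with ⟨d, rfl⟩ | ⟨q, rfl⟩
      · exact ⟨d • w, Submodule.mem_span_singleton.mpr ⟨d, rfl⟩, by rw [smul_smul]⟩
      -- Here `s = a * q` and `w = k • n + q • m`. As `w` is divisible by no non-unit, `q` or `k` is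
      -- a unit.
      obtain ⟨k, n, hk, hkn⟩ := ha a (w - q • m) (by rw [smul_sub, hzm, smul_smul, sub_self])
      by_cases hq : IsUnit q
      · obtain ⟨d, hd⟩ := hq.exists_right_inv
        exact ⟨d • w, Submodule.mem_span_singleton.mpr ⟨d, rfl⟩, by
          rw [smul_smul, mul_assoc, hd, mul_one]⟩
      by_cases hku : IsUnit k
      · have : a = 0 := hku.mul_right_eq_zero.mp hk
        exact ⟨0, zero_mem _, by rw [this, zero_smul, smul_zero]⟩
      obtain ⟨p, y, hp, hy⟩ := exists_add_smul_eq_smul hd k q n m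
      rw [← hkn, sub_add_cancel] at hy
      refine absurd (hwp p y hy) ?_
      rcases hp with rfl | rfl <;> assumption)
  refine ⟨R ∙ w, V, ?_, Submodule.mem_span_singleton.mpr ⟨r, hw.symm⟩, hV⟩
  have hinj : Function.Injective (LinearMap.toSpanSingleton R M w) := by
    rw [injective_iff_map_eq_zero]
    exact fun s hs => ha.smul_eq_zero_iff hwp hs
  have e := LinearEquiv.ofInjective _ hinj
  rw [LinearMap.range_toSpanSingleton] at e
  exact Module.Free.of_equiv e

/-- The elements `z` with `s • z` a multiple of `y` for some regular `s`. -/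
def regularClosure {M : Type v} [AddCommGroup M] [Module R M] (y : M) : Submodule R M where
  carrier := {z | ∃ s ∈ nonZeroDivisors R, ∃ t : R, s • z = t • y}
  zero_mem' := ⟨1, one_mem _, 0, by simp⟩
  add_mem' := by
    rintro z z' ⟨s, hs, t, h⟩ ⟨s', hs', t', h'⟩
    refine ⟨s * s', mul_mem hs hs', s' * t + s * t', ?_⟩
    rw [smul_add, mul_comm s, mul_smul, h, mul_comm, mul_smul, h', smul_smul, smul_smul, add_smul]
  smul_mem' := by
    rintro c z ⟨s, hs, t, h⟩
    exact ⟨s, hs, c * t, by rw [smul_comm, h, smul_smul]⟩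

/-- In a singly projective module over a maximal valuation ring each element lies in a uniserial
direct summand. -/
theorem HasAnnihilatorFactors.exists_uniserial_summand (hd : ∀ a b : R, a ∣ b ∨ b ∣ a)
    (hm : IsMaximalValuationRing R) {M : Type u} [AddCommGroup M] [Module R M]
    (h : HasAnnihilatorFactors R M) (x : M) :
    ∃ U V : Submodule R M, IsUniserialModule R U ∧ x ∈ U ∧ IsCompl U V := by
  by_cases hx : x = 0
  · exact ⟨⊥, ⊤, fun A B => Or.inl (le_of_eq (Subsingleton.elim A B)), by simp [hx],
      isCompl_bot_top⟩
  have hreg : ∀ s ∈ nonZeroDivisors R, ∀ z : M, s • z = 0 → z = 0 := by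
    intro s hs z hz
    obtain ⟨r, w, hw, hr⟩ := h z
    rw [hw, (mem_nonZeroDivisors_iff_left.mp hs) r (hr s hz), zero_smul]
  have ha := h.annihilatorDivisible
  obtain ⟨r₀, y, hxy, hy⟩ := h.exists_eq_smul hd hx
  have huni : IsUniserialModule R (regularClosure (R := R) y) :=
    isUniserialModule_of_forall_mem_span_singleton (by
      rintro ⟨z, s, hs, t, hz⟩ ⟨z', s', hs', t', hz'⟩
      have key : ∀ (z z' : M) (s s' t t' q : R), s ∈ nonZeroDivisors R → s' ∈ nonZeroDivisors R →
          s • z = t • y → s' • z' = t' • y → s' * t = s * t' * q → z = q • z' := by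
        intro z z' s s' t t' q hs hs' hz hz' hq
        refine sub_eq_zero.mp (hreg (s * s') (mul_mem hs hs') _ ?_)
        have h1 : (s * s') • z = (s' * t) • y := by rw [mul_comm, mul_smul, hz, smul_smul]
        have h2 : (s * s') • q • z' = (s * t' * q) • y := by
          rw [mul_smul, smul_comm s' q, hz', smul_smul, smul_smul]
          congr 1
          ring
        rw [smul_sub, h1, h2, hq, sub_self]
      rcases hd (s * t') (s' * t) with ⟨q, hq⟩ | ⟨q, hq⟩
      · left
        exact Submodule.mem_span_singleton.mpr
          ⟨q, Subtype.ext (key z z' s s' t t' q hs hs' hz hz' hq).symm⟩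
      · right
        exact Submodule.mem_span_singleton.mpr
          ⟨q, Subtype.ext (key z' z s' s t' t q hs' hs hz' hz hq).symm⟩)
  obtain ⟨V, hV⟩ := hm.exists_isCompl hd (regularClosure y) huni (by
      rintro z ⟨σ, hσ, τ, hz⟩ s m hzm
      by_cases hz0 : z = 0
      · exact ⟨0, zero_mem _, by rw [hz0, smul_zero]⟩
      -- Take `y' = y` if `σ ∣ τ`. Otherwise `τ` is regular as a factor of `σ`, so `y` is a multiple
      -- of `z` and `y' = z` has zero annihilator.
      obtain ⟨u, y', hy'U, hy'0, hzu⟩ : ∃ (u : R) (y' : M), y' ∈ regularClosure (R := R) y ∧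
          (∀ k : R, k • y' = 0 → k = 0) ∧ z = u • y' := by
        rcases hd σ τ with ⟨t, rfl⟩ | ⟨t, rfl⟩
        · refine ⟨t, y, ⟨1, one_mem _, 1, rfl⟩, hy, sub_eq_zero.mp (hreg σ hσ _ ?_)⟩
          rw [smul_sub, hz, smul_smul, sub_self]
        · refine ⟨1, z, ⟨_, hσ, _, hz⟩, fun k hk => hy k ?_, (one_smul R z).symm⟩
          have htz : t • z - y = 0 := hreg τ (mul_mem_nonZeroDivisors.mp hσ).1 _ (by
            rw [smul_sub, smul_smul, hz, sub_self])
          rw [← sub_eq_zero.mp htz, smul_comm, hk, smul_zero]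
      obtain ⟨r, w, hw, hw0⟩ := h.exists_eq_smul hd (x := m) (by
        rintro rfl
        exact hz0 (by rw [hzm, smul_zero]))
      rcases hd s u with ⟨d, rfl⟩ | ⟨a, rfl⟩
      · exact ⟨d • y', Submodule.smul_mem _ _ hy'U, by rw [hzu, smul_smul]⟩
      have heq : u • y' = (u * a * r) • w := by rw [← hzu, hzm, hw, smul_smul]
      -- This makes `a` regular, so dividing `y'` by `a` stays inside the regular closure.
      have harr : ∀ k, k * (a * r) = 0 → k = 0 := by
        intro k hk
        rcases hd u k with ⟨l, rfl⟩ | ⟨l, rfl⟩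
        · refine hy'0 _ ?_
          rw [mul_comm, mul_smul, heq, smul_smul,
            show l * (u * a * r) = u * l * (a * r) by ring, hk, zero_smul]
        · refine absurd ?_ hz0
          rw [hzu, heq, show k * l * a * r = l * (k * (a * r)) by ring, hk, mul_zero, zero_smul]
      have har : a ∈ nonZeroDivisors R := by
        refine mem_nonZeroDivisors_iff_right.mpr fun k hk => harr k ?_
        rw [← mul_assoc, hk, zero_mul]
      obtain ⟨k, n, hk, hkn⟩ := ha u (y' - (a * r) • w) (by
        rw [smul_sub, heq, smul_smul, mul_assoc, sub_self])
      -- If instead `k ∣ a`, then `k` is regular too, and `k * u = 0` forces `z = 0`.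
      obtain ⟨k', rfl⟩ : a ∣ k := by
        rcases hd a k with h | ⟨d, rfl⟩
        · exact h
        · refine absurd ?_ hz0
          have hkr := (mul_mem_nonZeroDivisors.mp har).1
          rw [hzu, (mem_nonZeroDivisors_iff_left.mp hkr) u hk, zero_smul]
      have hy'a : y' = a • (r • w + k' • n) := by
        rw [smul_add, smul_smul, smul_smul, ← hkn, add_sub_cancel]
      obtain ⟨σ', hσ', τ', hy'τ⟩ := hy'U
      refine ⟨r • w + k' • n, ⟨σ' * a, mul_mem hσ' har, τ', ?_⟩, ?_⟩
      · rw [mul_smul, ← hy'a, hy'τ]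
      · rw [hzu, mul_smul, ← hy'a])
  exact ⟨regularClosure y, V, huni, ⟨1, one_mem _, r₀, by rw [one_smul, hxy]⟩, hV⟩

end Sufficiency

/-! ### Absorbing finite sets into direct summands. -/

section Summands

variable {R : Type u} [CommRing R] {M : Type u} [AddCommGroup M] [Module R M]

/-- Finite subsets lie in direct summands with property `P`, provided `P` is preserved by adding
summands with property `T` and each element of a summand lies in a smaller summand with property
`T`. -/
theorem exists_summand_of_finite {P T : Submodule R M → Prop} (hbot : P ⊥)
    (hsup : ∀ N U, P N → T U → Disjoint N U → P (N ⊔ U))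
    (hstep : ∀ N N' : Submodule R M, IsCompl N N' → ∀ x ∈ N', ∃ U V : Submodule R M,
      T U ∧ x ∈ U ∧ U ⊔ V = N' ∧ Disjoint U V)
    {S : Set M} (hS : S.Finite) :
    ∃ N : Submodule R M, P N ∧ S ⊆ N ∧ ∃ N' : Submodule R M, IsCompl N N' := by
  induction S, hS using Set.Finite.induction_on with
  | empty => exact ⟨⊥, hbot, Set.empty_subset _, ⊤, isCompl_bot_top⟩
  | @insert x S _ _ ih =>
    obtain ⟨N, hP, hSN, N', hN⟩ := ih
    obtain ⟨n, hn, x', hx', rfl⟩ := Submodule.mem_sup.mp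
      (hN.sup_eq_top.ge (Submodule.mem_top (x := x)))
    obtain ⟨U, V, hT, hxU, rfl, hUV⟩ := hstep N N' hN x' hx'
    refine ⟨N ⊔ U, hsup N U hP hT (hN.disjoint.mono_right le_sup_left), ?_, V, ?_, ?_⟩
    · refine Set.insert_subset (Submodule.add_mem_sup hn hxU) fun y hy => ?_
      exact Submodule.mem_sup_left (hSN hy)
    · exact hUV.disjoint_sup_left_of_disjoint_sup_right hN.disjoint
    · rw [codisjoint_iff, sup_assoc]
      exact hN.sup_eq_top

theorem IsCompl.map_subtype {N' : Submodule R M} {U V : Submodule R N'} (h : IsCompl U V) :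
    U.map N'.subtype ⊔ V.map N'.subtype = N' ∧
      Disjoint (U.map N'.subtype) (V.map N'.subtype) := by
  refine ⟨?_, Submodule.disjoint_map N'.injective_subtype h.disjoint⟩
  rw [← Submodule.map_sup, h.sup_eq_top, Submodule.map_subtype_top]

theorem Module.Free.sup_of_disjoint {N U : Submodule R M} [Module.Free R N] [Module.Free R U]
    (h : Disjoint N U) : Module.Free R (N ⊔ U : Submodule R M) := by
  have hinj : Function.Injective (N.subtype.coprod U.subtype) := by
    rw [← LinearMap.ker_eq_bot, LinearMap.ker_coprod_of_disjoint_range]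
    · simp
    · simpa using h
  have e := LinearEquiv.ofInjective _ hinj
  rw [← Submodule.sup_eq_range] at e
  exact Module.Free.of_equiv e

/-- Being a direct sum of finitely many uniserial submodules. -/
def IsFiniteSumOfUniserials (N : Submodule R M) : Prop :=
  ∃ (n : ℕ) (U : Fin n → Submodule R M),
    (∀ i, IsUniserialModule R (U i)) ∧ iSupIndep U ∧ (⨆ i, U i) = N

theorem isFiniteSumOfUniserials_bot : IsFiniteSumOfUniserials (⊥ : Submodule R M) :=
  ⟨0, Fin.elim0, fun i => i.elim0, fun i => i.elim0, by simp⟩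

theorem IsFiniteSumOfUniserials.sup {N V : Submodule R M} (hN : IsFiniteSumOfUniserials N)
    (hV : IsUniserialModule R V) (h : Disjoint N V) : IsFiniteSumOfUniserials (N ⊔ V) := by
  obtain ⟨n, U, hU, hind, rfl⟩ := hN
  let W : Option (Fin n) → Submodule R M := fun o => o.elim V U
  have hW : iSupIndep W := by
    rintro (_ | i)
    · refine h.symm.mono_right (iSup₂_le ?_)
      rintro (_ | j) hj
      · exact absurd rfl hj
      · exact le_iSup U j
    · have hle : (⨆ (o) (_ : o ≠ some i), W o) ≤ (⨆ (j) (_ : j ≠ i), U j) ⊔ V := by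
        refine iSup₂_le ?_
        rintro (_ | j) hj
        · exact le_sup_right
        · refine le_trans ?_ le_sup_left
          exact le_iSup₂_of_le j (fun hji => hj (congrArg some hji)) le_rfl
      refine Disjoint.mono_right hle ?_
      refine (hind i).disjoint_sup_right_of_disjoint_sup_left (h.mono_left ?_)
      rw [← iSup_split_single]
  have e : Fin (n + 1) ≃ Option (Fin n) := finSuccEquiv n
  refine ⟨n + 1, W ∘ e, fun i => ?_, hW.comp e.injective, ?_⟩
  · change IsUniserialModule R (W (e i))
    rcases e i with _ | j
    · exact hV
    · exact hU j
  · refine (e.iSup_comp (g := W)).trans ?_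
    rw [iSup_option, sup_comm]
    rfl

end Summands

/-! ### Assembly of the equivalences. -/

section Main

variable {R : Type u} [CommRing R] {M : Type u} [AddCommGroup M] [Module R M]

/-- The factorization property passes to retracts, so it holds in every complement met while
splitting off uniserial summands. -/
theorem HasAnnihilatorFactors.isSeparableModule (hd : ∀ a b : R, a ∣ b ∨ b ∣ a)
    (hm : IsMaximalValuationRing R) (h : HasAnnihilatorFactors R M) : IsSeparableModule R M := by
  intro S hS
  obtain ⟨N, hN, hSN, hcompl⟩ := exists_summand_of_finite (P := IsFiniteSumOfUniserials)
    (T := fun U : Submodule R M => IsUniserialModule R U) isFiniteSumOfUniserials_bot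
    (fun N U hN hU hNU => hN.sup hU hNU) (fun N N' hN x hx => by
      obtain ⟨U, V, hU, hxU, hUV⟩ := (h.of_retract N'.subtype (N'.projectionOnto N hN.symm)
        (Submodule.projectionOnto_apply_left hN.symm)).exists_uniserial_summand hd hm ⟨x, hx⟩
      refine ⟨U.map N'.subtype, V.map N'.subtype, ?_, ⟨_, hxU, rfl⟩, hUV.map_subtype⟩
      have e := Submodule.equivMapOfInjective N'.subtype N'.injective_subtype U
      exact hU.of_surjective e.toLinearMap e.surjective) hS
  exact ⟨N, hSN, hcompl, hN⟩

theorem HasContentFactors.isLocallyProjective (hR : IsUniserialValuationRing R)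
    (hm : IsMaximalValuationRing R) (hc : HasContentFactors R M) (ha : AnnihilatorDivisible R M) :
    IsLocallyProjective R M := by
  rintro _ ⟨S, rfl⟩
  obtain ⟨N, hN, hSN, N', hcompl⟩ := exists_summand_of_finite
    (P := fun U : Submodule R M => Module.Free R U)
    (T := fun U : Submodule R M => Module.Free R U) inferInstance
    (fun N U hN hU hNU => Module.Free.sup_of_disjoint hNU) (fun N N' hN x hx => by
      have hp := Submodule.projectionOnto_apply_left hN.symm
      obtain ⟨U, V, hU, hxU, hUV⟩ := (hc.of_retract N'.subtype _ hp).exists_free_summand hR hm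
        (ha.of_retract N'.subtype _ hp) ⟨x, hx⟩
      refine ⟨U.map N'.subtype, V.map N'.subtype, ?_, ⟨_, hxU, rfl⟩, hUV.map_subtype⟩
      exact Module.Free.of_equiv
        (Submodule.equivMapOfInjective N'.subtype N'.injective_subtype U)) S.finite_toSet
  refine ⟨N, inferInstance, inferInstance, hN, N.projectionOnto N' hcompl, N.subtype,
    fun x hx => ?_⟩
  rw [Submodule.projectionOnto_apply_of_mem_left hcompl (Submodule.span_le.mpr hSN hx)]
  rfl

end Main

theorem mainTheorem4 (R : Type u) [CommRing R] (hR : IsUniserialValuationRing R) :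
    List.TFAE [
      IsMaximalValuationRing R,
      ∀ (M : Type u) [AddCommGroup M] [Module R M],
        IsSinglyProjective R M → IsSeparableModule R M,
      ∀ (M : Type u) [AddCommGroup M] [Module R M],
        Module.Flat R M → IsContentModule R M → IsLocallyProjective R M] := by
  have hd := hR.dvd_total
  tfae_have 1 → 2 := fun hm M _ _ hM =>
    ((isSinglyProjective_iff_hasAnnihilatorFactors hd).mp hM).isSeparableModule hd hm
  tfae_have 1 → 3 := fun hm M _ _ hflat hM =>
    ((isContentModule_iff_hasContentFactors hd).mp hM).isLocallyProjective hR hm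
      (annihilatorDivisible_of_flat hd)
  tfae_have 2 → 1 := fun h => isMaximalValuationRing_of_retraction hd fun Y _ _ e ha hc he =>
    (h Y ((isSinglyProjective_iff_hasAnnihilatorFactors hd).mpr
      (hc.hasAnnihilatorFactors hd ha))).exists_retraction hd ha he
  tfae_have 3 → 1 := fun h => isMaximalValuationRing_of_retraction hd fun Y _ _ e ha hc he =>
    (h Y (ha.flat hd) ((isContentModule_iff_hasContentFactors hd).mpr hc)).exists_retraction hd he
  tfae_finish
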